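/- Write $\mathbb D$ for the open unit disk and $\mathbb T$ for the unit circle. Let $m,n\ge 0$ and let $p\in\mathbb C[z_1,z_2]$ be a polynomial without zeros on $\mathbb D^2$ such that $p$ and $\tilde p(z)=z_1^m z_2^n\,\overline{p(1/\bar z_1,1/\bar z_2)}$ are polynomials without common factors and $m$, $n$ are the highest degrees of $z_1$, $z_2$ occurring in $p$ or $\tilde p$; thus $\Theta=\tilde p/p$ is a rational inner function on $\mathbb D^2$ of degree $(m,n)$. Let $\mathcal K_\Theta=H^2(\mathbb D^2)\ominus\Theta H^2(\mathbb D^2)$, and let $\mathcal K_\Theta=\mathcal S_1\oplus\mathcal S_2$ be any orthogonal decomposition into closed subspaces with $z_1\mathcal S_1\subseteq\mathcal S_1$ and $z_2\mathcal S_2\subseteq\mathcal S_2$. Let $S^1_\Theta=P_{\mathcal S_2}M_{z_1}|_{\mathcal S_2}$ be the compression to $\mathcal S_2$ of multiplication by $z_1$. Let $$E_\Theta=\{\tau\in\mathbb T:\ p(\tau_1,\tau)=0\text{ for some }\tau_1\in\mathbb T\},$$ and for $\tau\in\mathbb T\setminus E_\Theta$ let $S_{\Theta_\tau}=P_{\mathcal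 K_{\Theta_\tau}}M_z|_{\mathcal K_{\Theta_\tau}}$ be the compressed shift on the one-variable model space $\mathcal K_{\Theta_\tau}=H^2(\mathbb D)\ominus\Theta_\tau H^2(\mathbb D)$ of the slice $\Theta_\tau=\Theta(\cdot,\tau)$. For a bounded operator $T$ let $\mathcal W(T)=\{\langle Th,h\rangle:\|h\|=1\}$ be its numerical range. Then $E_\Theta$ is finite, and $$\mathrm{Clos}\big(\mathcal W(S^1_\Theta)\big)=\mathrm{Clos}\Big(\mathrm{Conv}\Big(\bigcup_{\tau\in\mathbb T\setminus E_\Theta}\mathcal W(S_{\Theta_\tau})\Big)\Big).$$ -/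

import Mathlib

open scoped ENNReal ComplexConjugate

noncomputable section

/-! ### Numerical ranges and compressions of operators -/

/-- The numerical range `{⟨T h, h⟩ : ‖h‖ = 1}` of a bounded operator `T`. Mathlib's inner product
is conjugate-linear in the first argument, so `⟨T h, h⟩` is written `inner ℂ h (T h)`. -/
def numericalRange {H : Type*} [NormedAddCommGroup H] [InnerProductSpace ℂ H]
    (T : H →L[ℂ] H) : Set ℂ :=
  {c | ∃ h : H, ‖h‖ = 1 ∧ inner ℂ h (T h) = c}

/-- The compression `P_S T|_S : S → S` of a bounded operator `T`, with `P_S` the orthogonal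
projection onto `S`. -/
def compression {H : Type*} [NormedAddCommGroup H] [InnerProductSpace ℂ H]
    (T : H →L[ℂ] H) (S : Submodule ℂ H) [S.HasOrthogonalProjection] : S →L[ℂ] S :=
  S.orthogonalProjectionOnto ∘L T ∘L S.subtypeL

/-! ### Shifting the index of a square-summable family -/

/-- For an injective map `e` of the index set, the isometry of `ℓ²` that puts the `i`-th
coordinate of `f` at place `e i` and `0` at the places outside the range of `e`. -/
def reindexIsometry {ι : Type*} (e : ι ↪ ι) :
    lp (fun _ : ι => ℂ) 2 →ₗᵢ[ℂ] lp (fun _ : ι => ℂ) 2 where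
  toFun f := ⟨Function.extend e f 0, by
    have h2 : (0 : ℝ) < (2 : ℝ≥0∞).toReal := by simp
    refine (memℓp_gen_iff h2).2 ?_
    refine (e.injective.summable_iff ?_).1 ?_
    · intro i hi
      rw [Function.extend_apply' _ _ _ (by simpa using hi)]
      simp
    · have := (memℓp_gen_iff h2).1 (lp.memℓp f)
      simpa [Function.comp_def, e.injective.extend_apply] using this⟩
  map_add' f g := by
    ext j
    change Function.extend e (⇑f + ⇑g) 0 j = Function.extend e f 0 j + Function.extend e g 0 j
    by_cases hj : ∃ i, e i = j
    · obtain ⟨i, rfl⟩ := hj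
      simp only [e.injective.extend_apply, Pi.add_apply]
    · simp [Function.extend_apply' _ _ _ hj]
  map_smul' c f := by
    ext j
    by_cases hj : ∃ i, e i = j
    · obtain ⟨i, rfl⟩ := hj
      simp [e.injective.extend_apply]
    · simp [Function.extend_apply' _ _ _ hj]
  norm_map' f := by
    have h2 : (0 : ℝ) < (2 : ℝ≥0∞).toReal := by simp
    rw [lp.norm_eq_tsum_rpow h2, lp.norm_eq_tsum_rpow h2]
    congr 1
    change ∑' j, ‖Function.extend e f 0 j‖ ^ (2 : ℝ≥0∞).toReal = _
    rw [← e.injective.tsum_eq]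
    · simp [e.injective.extend_apply]
    · intro j hj
      by_contra hj'
      apply hj
      simp [Function.extend_apply' (f := e) (f : ι → ℂ) 0 j (by simpa using hj')]

/-! ### The Hardy space of the disk, model spaces and the shift -/

/-- The Hardy space `H²(𝔻)`: the power series `∑ aₖ zᵏ` with square-summable coefficients, the
norm and the inner product being those of the coefficient sequences. -/
abbrev H2Disk : Type := lp (fun _ : ℕ => ℂ) 2

/-- The value at the point `z` of the disk of a function of `H²(𝔻)`. -/
def H2Disk.eval (f : H2Disk) (z : ℂ) : ℂ := ∑' k : ℕ, f k * z ^ k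

theorem H2Disk.summable_eval (f : H2Disk) {z : ℂ} (hz : ‖z‖ < 1) :
    Summable fun k : ℕ => f k * z ^ k := by
  refine .of_norm_bounded (g := fun k => ‖f‖ * ‖z‖ ^ k)
    ((summable_geometric_of_lt_one (norm_nonneg _) hz).mul_left _) fun k => ?_
  rw [norm_mul, norm_pow]
  gcongr
  exact lp.norm_apply_le_norm (by simp) f k

/-- The subspace `θ H²(𝔻)` of `H²(𝔻)`. -/
def H2Disk.multiples (θ : ℂ → ℂ) : Submodule ℂ H2Disk where
  carrier := {g | ∃ f : H2Disk, ∀ z : ℂ, ‖z‖ < 1 → g.eval z = θ z * f.eval z}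
  zero_mem' := ⟨0, fun z _ => by simp [H2Disk.eval]⟩
  add_mem' := by
    rintro g g' ⟨f, hf⟩ ⟨f', hf'⟩
    have key : ∀ (a b : H2Disk) {z : ℂ}, ‖z‖ < 1 → (a + b).eval z = a.eval z + b.eval z := by
      intro a b z hz
      simp only [H2Disk.eval]
      rw [← (a.summable_eval hz).tsum_add (b.summable_eval hz)]
      simp [add_mul]
    refine ⟨f + f', fun z hz => ?_⟩
    rw [key _ _ hz, key _ _ hz, hf z hz, hf' z hz]
    ring
  smul_mem' := by
    rintro c g ⟨f, hf⟩
    have key : ∀ (a : H2Disk) (z : ℂ), (c • a).eval z = c * a.eval z := by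
      intro a z
      simp [H2Disk.eval, mul_assoc, tsum_mul_left]
    refine ⟨c • f, fun z hz => ?_⟩
    rw [key, key, hf z hz]
    ring

/-- The model space `K_θ = H²(𝔻) ⊖ θ H²(𝔻)`. -/
def H2Disk.modelSpace (θ : ℂ → ℂ) : Submodule ℂ H2Disk := (H2Disk.multiples θ)ᗮ

instance H2Disk.modelSpace_hasOrthogonalProjection (θ : ℂ → ℂ) :
    (H2Disk.modelSpace θ).HasOrthogonalProjection :=
  inferInstanceAs ((H2Disk.multiples θ)ᗮ).HasOrthogonalProjection

/-- Multiplication by `z` on `H²(𝔻)`: the `k`-th coefficient becomes the `(k+1)`-st. -/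
def H2Disk.shift : H2Disk →L[ℂ] H2Disk :=
  (reindexIsometry ⟨fun k : ℕ => k + 1, fun _ _ h => by simpa using h⟩).toContinuousLinearMap

/-- The compressed shift `S_θ = P_{K_θ} M_z |_{K_θ}` on the model space of `θ`. -/
def H2Disk.compressedShift (θ : ℂ → ℂ) :
    H2Disk.modelSpace θ →L[ℂ] H2Disk.modelSpace θ :=
  compression H2Disk.shift (H2Disk.modelSpace θ)

/-! ### The Hardy space of the bidisk, model spaces and the coordinate shifts -/

/-- The Hardy space `H²(𝔻²)`: the power series `∑ aⱼₖ z₁ʲ z₂ᵏ` with square-summable coefficients,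
the norm and the inner product being those of the coefficient families. -/
abbrev H2Bidisk : Type := lp (fun _ : ℕ × ℕ => ℂ) 2

/-- The value at the point `(z₁, z₂)` of the bidisk of a function of `H²(𝔻²)`. -/
def H2Bidisk.eval (f : H2Bidisk) (z₁ z₂ : ℂ) : ℂ :=
  ∑' k : ℕ × ℕ, f k * (z₁ ^ k.1 * z₂ ^ k.2)

theorem H2Bidisk.summable_eval (f : H2Bidisk) {z₁ z₂ : ℂ} (h₁ : ‖z₁‖ < 1) (h₂ : ‖z₂‖ < 1) :
    Summable fun k : ℕ × ℕ => f k * (z₁ ^ k.1 * z₂ ^ k.2) := by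
  refine .of_norm_bounded (g := fun k : ℕ × ℕ => ‖f‖ * (‖z₁‖ ^ k.1 * ‖z₂‖ ^ k.2))
    (((summable_geometric_of_lt_one (norm_nonneg _) h₁).mul_of_nonneg
      (summable_geometric_of_lt_one (norm_nonneg _) h₂)
      (fun _ => by positivity) (fun _ => by positivity)).mul_left _) fun k => ?_
  rw [norm_mul, norm_mul, norm_pow, norm_pow]
  gcongr
  exact lp.norm_apply_le_norm (by simp) f k

/-- The subspace `Θ H²(𝔻²)` of `H²(𝔻²)`. -/
def H2Bidisk.multiples (Θ : ℂ → ℂ → ℂ) : Submodule ℂ H2Bidisk where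
  carrier := {g | ∃ f : H2Bidisk, ∀ z₁ z₂ : ℂ, ‖z₁‖ < 1 → ‖z₂‖ < 1 →
    g.eval z₁ z₂ = Θ z₁ z₂ * f.eval z₁ z₂}
  zero_mem' := ⟨0, fun z₁ z₂ _ _ => by simp [H2Bidisk.eval]⟩
  add_mem' := by
    rintro g g' ⟨f, hf⟩ ⟨f', hf'⟩
    have key : ∀ (a b : H2Bidisk) {z₁ z₂ : ℂ}, ‖z₁‖ < 1 → ‖z₂‖ < 1 →
        (a + b).eval z₁ z₂ = a.eval z₁ z₂ + b.eval z₁ z₂ := by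
      intro a b z₁ z₂ h₁ h₂
      simp only [H2Bidisk.eval]
      rw [← (a.summable_eval h₁ h₂).tsum_add (b.summable_eval h₁ h₂)]
      simp [add_mul]
    refine ⟨f + f', fun z₁ z₂ h₁ h₂ => ?_⟩
    rw [key _ _ h₁ h₂, key _ _ h₁ h₂, hf z₁ z₂ h₁ h₂, hf' z₁ z₂ h₁ h₂]
    ring
  smul_mem' := by
    rintro c g ⟨f, hf⟩
    have key : ∀ (a : H2Bidisk) (z₁ z₂ : ℂ), (c • a).eval z₁ z₂ = c * a.eval z₁ z₂ := by
      intro a z₁ z₂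
      simp [H2Bidisk.eval, mul_assoc, tsum_mul_left]
    refine ⟨c • f, fun z₁ z₂ h₁ h₂ => ?_⟩
    rw [key, key, hf z₁ z₂ h₁ h₂]
    ring

/-- The two-variable model space `K_Θ = H²(𝔻²) ⊖ Θ H²(𝔻²)`. -/
def H2Bidisk.modelSpace (Θ : ℂ → ℂ → ℂ) : Submodule ℂ H2Bidisk := (H2Bidisk.multiples Θ)ᗮ

/-- Multiplication by `z₁` on `H²(𝔻²)`. -/
def H2Bidisk.shift₁ : H2Bidisk →L[ℂ] H2Bidisk :=
  (reindexIsometry ⟨fun k : ℕ × ℕ => (k.1 + 1, k.2), fun _ _ h => by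
    simpa [Prod.ext_iff] using h⟩).toContinuousLinearMap

/-- Multiplication by `z₂` on `H²(𝔻²)`. -/
def H2Bidisk.shift₂ : H2Bidisk →L[ℂ] H2Bidisk :=
  (reindexIsometry ⟨fun k : ℕ × ℕ => (k.1, k.2 + 1), fun _ _ h => by
    simpa [Prod.ext_iff] using h⟩).toContinuousLinearMap

/-- `K_Θ = S₁ ⊕ S₂` is an orthogonal decomposition into closed subspaces, with `S₁` invariant
under multiplication by `z₁` and `S₂` invariant under multiplication by `z₂`. -/
structure IsShiftDecomposition (Θ : ℂ → ℂ → ℂ) (S₁ S₂ : ClosedSubmodule ℂ H2Bidisk) : Prop where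
  orthogonal : S₁.toSubmodule ⟂ S₂.toSubmodule
  sup_eq : S₁.toSubmodule ⊔ S₂.toSubmodule = H2Bidisk.modelSpace Θ
  shift₁_mem : ∀ f ∈ S₁, H2Bidisk.shift₁ f ∈ S₁
  shift₂_mem : ∀ f ∈ S₂, H2Bidisk.shift₂ f ∈ S₂

/-! ### Rational inner functions on the bidisk -/

/-- The reflection `p̃(z) = z₁ᵐ z₂ⁿ conj (p (1 / conj z₁, 1 / conj z₂))` of a polynomial `p` of
degree at most `(m, n)`: the coefficient `c` of `z₁ʲ z₂ᵏ` gives `conj c` at `z₁ᵐ⁻ʲ z₂ⁿ⁻ᵏ`. -/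
def reflectedPoly (m n : ℕ) (p : MvPolynomial (Fin 2) ℂ) : MvPolynomial (Fin 2) ℂ :=
  ∑ s ∈ p.support,
    MvPolynomial.monomial (Finsupp.single 0 (m - s 0) + Finsupp.single 1 (n - s 1))
      (conj (p.coeff s))

theorem eval_reflectedPoly {m n : ℕ} {p : MvPolynomial (Fin 2) ℂ}
    (hm : p.degreeOf 0 ≤ m) (hn : p.degreeOf 1 ≤ n) {z₁ z₂ : ℂ} (h₁ : z₁ ≠ 0) (h₂ : z₂ ≠ 0) :
    MvPolynomial.eval ![z₁, z₂] (reflectedPoly m n p) =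
      z₁ ^ m * z₂ ^ n * conj (MvPolynomial.eval ![(conj z₁)⁻¹, (conj z₂)⁻¹] p) := by
  rw [MvPolynomial.eval_eq' _ p, reflectedPoly, map_sum, map_sum, Finset.mul_sum]
  refine Finset.sum_congr rfl fun s hs => ?_
  have hs0 : s 0 ≤ m := (MvPolynomial.degreeOf_le_iff.1 hm) s hs
  have hs1 : s 1 ≤ n := (MvPolynomial.degreeOf_le_iff.1 hn) s hs
  rw [MvPolynomial.eval_monomial, Finsupp.prod_fintype _ _ (by simp)]
  simp only [Fin.prod_univ_two, map_mul, map_pow, Finsupp.coe_add, Pi.add_apply]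
  simp [pow_sub₀ _ h₁ hs0, pow_sub₀ _ h₂ hs1]
  ring

/-- `Θ = p̃ / p` is a rational inner function on the bidisk of degree `(m, n)`, written in lowest
terms: `p` has no zeros on the open bidisk, `p` and `p̃` have no common factors, and `m` and `n`
are the highest degrees of `z₁` and of `z₂` that occur in `p` or `p̃`. -/
structure IsRationalInner (p : MvPolynomial (Fin 2) ℂ) (m n : ℕ) : Prop where
  eval_ne_zero : ∀ z₁ z₂ : ℂ, ‖z₁‖ < 1 → ‖z₂‖ < 1 → MvPolynomial.eval ![z₁, z₂] p ≠ 0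
  isRelPrime : IsRelPrime p (reflectedPoly m n p)
  degree_fst : max (p.degreeOf 0) ((reflectedPoly m n p).degreeOf 0) = m
  degree_snd : max (p.degreeOf 1) ((reflectedPoly m n p).degreeOf 1) = n

/-- The function `Θ = p̃ / p`. -/
def rationalInner (p : MvPolynomial (Fin 2) ℂ) (m n : ℕ) (z₁ z₂ : ℂ) : ℂ :=
  MvPolynomial.eval ![z₁, z₂] (reflectedPoly m n p) / MvPolynomial.eval ![z₁, z₂] p

/-- The exceptional set of the `τ` in the unit circle `𝕋` for which `p(·, τ)` has a zero
on `𝕋`. -/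
def exceptionalSet (p : MvPolynomial (Fin 2) ℂ) : Set ℂ :=
  {τ | ‖τ‖ = 1 ∧ ∃ τ₁ : ℂ, ‖τ₁‖ = 1 ∧ MvPolynomial.eval ![τ₁, τ] p = 0}

end

/-! Restricting `z₂` to the circle embeds `H²(𝔻²)` isometrically into `L²(𝕋; H²(𝔻))` (`slice`).
There `z₁` acts on every slice as the shift of `H²(𝔻)`, while `z₂` acts on the slice at `τ` as the
scalar `τ`. Hence `⟨z₁ f, f⟩` is the integral of the same quadratic form over the slices of `f`.

The model space enters through `p f`: for `f ∈ K_Θ` its coefficients of index at least `(m, n)`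
vanish, being inner products of `f` with elements of `Θ H²`. Applied to `z₂ⁿ f` with `f ∈ S₂`, this
says that `p f` has `z₁`-degree less than `m` (`snd_le_lowFst`). For `τ` outside the finite
exceptional set, the model space of `Θ_τ` is exactly the set of `q / p(·, τ)` with `deg q < m`
(`mem_modelSpace_iff`). So almost every slice of `f` lies in the model space of its `Θ_τ`, and `⟨z₁
f, f⟩` is an average of slice values with weights `‖f_τ‖²`. Hahn–Banach separation gives one
inclusion (`inner_shift₁_mem_closure_convexHull`).

For the other inclusion, `S₂` may be replaced by the space `lowFst` of all `f` with `deg_{z₁} (p f)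
< m`. It lies between `S₂` and `K_Θ`, and it meets `S₁` in finite dimension. As `z₂ᴺ f` tends to `0`
weakly, its `S₁`-component tends to `0` in norm, and multiplication by `z₂ᴺ` does not change `⟨z₁ f,
f⟩` (`smul_inner_mem_closure_numericalRange`). In `lowFst` there are functions concentrating at a
given `τ`: eliminating `z₁` from `p` and `p̃` yields a nonzero `r(z₂)` with `|r| ≤ K |p|`, so `r /
p` lies in `H²(𝔻²)`, and the functions `(1 + conj τ z₂)ᴺ q r / p` have their mass near `τ`
(`smul_inner_inverse_mem_closure`). The finitely many zeros of `r` are reached by continuity in `τ`.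
Finally, the closed numerical range on `S₂` is convex because `f` and `z₂ᴺ g` decouple as `N → ∞`.
-/

open scoped ENNReal ComplexConjugate Polynomial
open Filter Topology MeasureTheory

noncomputable section

/-! ### Elimination -/

section Elimination

open Polynomial IsLocalization

/-- By Gauss's lemma, relatively prime polynomials over a factorial domain stay coprime over its
field of fractions, so that they combine to a nonzero constant. -/
theorem Polynomial.exists_mul_add_mul_eq_C_of_isRelPrime {R : Type*} [CommRing R] [IsDomain R]
    [UniqueFactorizationMonoid R] {f g : R[X]} (h : IsRelPrime f g) :
    ∃ a b : R[X], ∃ r : R, r ≠ 0 ∧ a * f + b * g = C r := by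
  classical
  let _ : NormalizedGCDMonoid R := Classical.choice inferInstance
  let K := FractionRing R
  have hinj : Function.Injective (algebraMap R K) := IsFractionRing.injective _ _
  have hcop : IsCoprime (f.map (algebraMap R K)) (g.map (algebraMap R K)) := by
    rw [← isRelPrime_iff_isCoprime]
    intro d hdf hdg
    rcases eq_or_ne d 0 with rfl | hd
    · rw [zero_dvd_iff, Polynomial.map_eq_zero_iff hinj] at hdf hdg
      subst hdf hdg
      exact absurd (h dvd_rfl dvd_rfl) not_isUnit_zero
    refine isUnit_or_eq_zero_of_isUnit_integerNormalization_primPart (R := R) hd ?_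
    obtain ⟨b, hb, hb'⟩ := integerNormalization_spec (nonZeroDivisors R) d
    have hprim := isPrimitive_primPart (integerNormalization (nonZeroDivisors R) d)
    -- Clearing denominators changes `d` only by a unit of `K`. By Gauss's lemma the primitive part
    -- then divides `f` and `g` already over `R`.
    have hdvd : (integerNormalization (nonZeroDivisors R) d).primPart.map (algebraMap R K) ∣ d := by
      have hu : IsUnit (C (algebraMap R K b)) :=
        isUnit_C.2 (isUnit_iff_ne_zero.2 (by
          rw [Ne, map_eq_zero_iff _ hinj]; exact nonZeroDivisors.ne_zero hb))
      rw [← hu.dvd_mul_left, ← algebraMap_apply, ← Algebra.smul_def, ← hb']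
      exact Polynomial.map_dvd _ (primPart_dvd _)
    exact h (hprim.dvd_of_fraction_map_dvd_fraction_map (hdvd.trans hdf))
      (hprim.dvd_of_fraction_map_dvd_fraction_map (hdvd.trans hdg))
  obtain ⟨a, b, hab⟩ := hcop
  obtain ⟨c, hc, hc'⟩ := integerNormalization_spec (nonZeroDivisors R) a
  obtain ⟨d, hd, hd'⟩ := integerNormalization_spec (nonZeroDivisors R) b
  refine ⟨C d * integerNormalization (nonZeroDivisors R) a,
    C c * integerNormalization (nonZeroDivisors R) b, c * d,
    mul_ne_zero (nonZeroDivisors.ne_zero hc) (nonZeroDivisors.ne_zero hd), ?_⟩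
  apply map_injective _ hinj
  rw [Algebra.smul_def, algebraMap_apply] at hc' hd'
  simp only [Polynomial.map_add, Polynomial.map_mul, map_C, hc', hd', C_mul]
  linear_combination (C (algebraMap R K c) * C (algebraMap R K d)) * hab

/-- Relatively prime polynomials in two variables combine to a nonzero polynomial in the second
variable. -/
theorem MvPolynomial.exists_eval_mul_add_mul_eq {k : Type*} [Field k]
    {p q : MvPolynomial (Fin 2) k} (h : IsRelPrime p q) :
    ∃ a b : MvPolynomial (Fin 2) k, ∃ r : k[X], r ≠ 0 ∧ ∀ x y : k,
      MvPolynomial.eval ![x, y] a * MvPolynomial.eval ![x, y] p +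
        MvPolynomial.eval ![x, y] b * MvPolynomial.eval ![x, y] q = r.eval y := by
  -- `finSuccEquiv` turns variable `0` into the polynomial variable, so the constant left by the
  -- elimination involves variable `1` only.
  let e := finSuccEquiv k 1
  obtain ⟨a, b, r, hr, hab⟩ := Polynomial.exists_mul_add_mul_eq_C_of_isRelPrime
    (f := e p) (g := e q) (by
      intro d hp hq
      have := h (d := e.symm d) (by simpa using map_dvd e.symm hp)
        (by simpa using map_dvd e.symm hq)
      simpa using this.map e)
  refine ⟨e.symm a, e.symm b, uniqueAlgEquiv k (Fin 1) r,
    (map_ne_zero_iff _ (AlgEquiv.injective _)).2 hr, fun x y => ?_⟩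
  have key : ∀ f, MvPolynomial.eval ![x, y] f =
      Polynomial.eval x (Polynomial.map (MvPolynomial.eval ![y]) (e f)) :=
    MvPolynomial.eval_eq_eval_mv_eval' ![y] x
  have h2 := congrArg (fun f => Polynomial.eval x (Polynomial.map (MvPolynomial.eval ![y]) f)) hab
  simp only [Polynomial.map_add, Polynomial.map_mul, Polynomial.eval_add, Polynomial.eval_mul,
    Polynomial.map_C, Polynomial.eval_C] at h2
  rw [key, key, key, key, e.apply_symm_apply, e.apply_symm_apply, h2]
  clear h2 hab hr
  induction r using MvPolynomial.induction_on with
  | C c => simp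
  | add f g hf hg => simp [hf, hg]
  | mul_X f i hf =>
    obtain rfl := Subsingleton.elim i 0
    simp [hf]

end Elimination

/-! ### Polynomials without zeros in the disk -/

section NoZeros

open Polynomial

theorem Polynomial.norm_eval_eq_prod_roots (q : ℂ[X]) (z : ℂ) :
    ‖q.eval z‖ = ‖q.leadingCoeff‖ * (q.roots.map fun a => ‖z - a‖).prod := by
  rw [(IsAlgClosed.splits q).eval_eq_prod_roots, norm_mul]
  congr 1
  exact (map_multiset_prod (normHom : ℂ →*₀ ℝ) _).trans (by rw [Multiset.map_map]; rfl)

/-- The difference of the squares is `(1 - |z|²)(|a|² - 1)`. -/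
theorem norm_one_sub_conj_mul_le {z a : ℂ} (hz : ‖z‖ ≤ 1) (ha : 1 ≤ ‖a‖) :
    ‖1 - conj z * a‖ ≤ ‖z - a‖ := by
  refine le_of_sq_le_sq ?_ (norm_nonneg _)
  rw [← Complex.normSq_eq_norm_sq, ← Complex.normSq_eq_norm_sq]
  have h1 : Complex.normSq z ≤ 1 := by rw [Complex.normSq_eq_norm_sq]; nlinarith [norm_nonneg z]
  have h2 : 1 ≤ Complex.normSq a := by rw [Complex.normSq_eq_norm_sq]; nlinarith [norm_nonneg a]
  simp only [Complex.normSq_apply] at *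
  simp
  nlinarith [mul_nonneg (sub_nonneg.2 h1) (sub_nonneg.2 h2)]

/-- The reflection of a polynomial without zeros in the disk is dominated by the polynomial. -/
theorem Polynomial.norm_pow_mul_eval_inv_conj_le {q : ℂ[X]} {n : ℕ} (hn : q.natDegree ≤ n)
    (hq : ∀ z : ℂ, ‖z‖ < 1 → q.eval z ≠ 0) {z : ℂ} (hz0 : z ≠ 0) (hz : ‖z‖ ≤ 1) :
    ‖z‖ ^ n * ‖q.eval (conj z)⁻¹‖ ≤ ‖q.eval z‖ := by
  have hcard : q.roots.card ≤ n := (card_roots' q).trans hn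
  have hroots : ∀ a ∈ q.roots, 1 ≤ ‖a‖ := fun a ha => by
    by_contra! h
    exact hq a h (isRoot_of_mem_roots ha)
  calc ‖z‖ ^ n * ‖q.eval (conj z)⁻¹‖ ≤ ‖z‖ ^ q.roots.card * ‖q.eval (conj z)⁻¹‖ := by
        gcongr ?_ * _
        exact pow_le_pow_of_le_one (norm_nonneg _) hz hcard
    _ = ‖q.leadingCoeff‖ * (q.roots.map fun a => ‖1 - conj z * a‖).prod := by
        rw [q.norm_eval_eq_prod_roots, mul_left_comm, ← Multiset.prod_replicate,
          ← Multiset.map_const', ← Multiset.prod_map_mul]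
        congr 3
        ext a
        rw [← Complex.norm_conj z, ← norm_mul, mul_sub, mul_inv_cancel₀ (by simpa using hz0)]
    _ ≤ ‖q.leadingCoeff‖ * (q.roots.map fun a => ‖z - a‖).prod := by
        gcongr
        refine Multiset.prod_map_le_prod_map₀ _ _ (fun _ _ => norm_nonneg _) fun a ha =>
          norm_one_sub_conj_mul_le hz (hroots a ha)
    _ = ‖q.eval z‖ := (q.norm_eval_eq_prod_roots z).symm

/-- Harnack's inequality for polynomials without zeros in the disk. -/
theorem Polynomial.norm_eval_harnack {q : ℂ[X]} {n : ℕ} (hn : q.natDegree ≤ n)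
    (hq : ∀ z : ℂ, ‖z‖ < 1 → q.eval z ≠ 0) {z z' : ℂ} (hz : ‖z‖ < 1) (hz' : ‖z'‖ ≤ 1) :
    ((1 - ‖z‖) / 2) ^ n * ‖q.eval z'‖ ≤ ‖q.eval z‖ := by
  have hcard : q.roots.card ≤ n := (card_roots' q).trans hn
  have hroots : ∀ a ∈ q.roots, 1 ≤ ‖a‖ := fun a ha => by
    by_contra! h
    exact hq a h (isRoot_of_mem_roots ha)
  have h0 : 0 ≤ (1 - ‖z‖) / 2 := by linarith
  calc ((1 - ‖z‖) / 2) ^ n * ‖q.eval z'‖ ≤ ((1 - ‖z‖) / 2) ^ q.roots.card * ‖q.eval z'‖ := by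
        gcongr ?_ * _
        exact pow_le_pow_of_le_one h0 (by linarith [norm_nonneg z]) hcard
    _ = ‖q.leadingCoeff‖ * (q.roots.map fun a => ((1 - ‖z‖) / 2) * ‖z' - a‖).prod := by
        rw [q.norm_eval_eq_prod_roots, mul_left_comm, ← Multiset.prod_replicate,
          ← Multiset.map_const', ← Multiset.prod_map_mul]
    _ ≤ ‖q.leadingCoeff‖ * (q.roots.map fun a => ‖z - a‖).prod := by
        gcongr
        refine Multiset.prod_map_le_prod_map₀ _ _ (fun _ _ => mul_nonneg h0 (norm_nonneg _))
          fun a ha => ?_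
        -- Each root has `|a| ≥ 1`, so `|z - a| ≥ |a| - |z| ≥ (1 - |z|)(1 + |a|) / 2`, and `1 + |a|
        -- ≥ |z' - a|`.
        have h1 := norm_sub_le z' a
        have h2 := norm_sub_norm_le a z
        rw [norm_sub_rev] at h2
        have h3 := hroots a ha
        nlinarith [norm_nonneg z, norm_nonneg a]
    _ = ‖q.eval z‖ := (q.norm_eval_eq_prod_roots z).symm

end NoZeros

/-! ### The slices of a polynomial in two variables -/

section Slices

open Polynomial

/-- The polynomial `p(·, τ)`. -/
def fstSlice (p : MvPolynomial (Fin 2) ℂ) (τ : ℂ) : ℂ[X] :=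
  MvPolynomial.aeval ![X, C τ] p

/-- The polynomial `p(ζ, ·)`. -/
def sndSlice (p : MvPolynomial (Fin 2) ℂ) (ζ : ℂ) : ℂ[X] :=
  MvPolynomial.aeval ![C ζ, X] p

theorem fstSlice_eq_sum (p : MvPolynomial (Fin 2) ℂ) (τ : ℂ) :
    fstSlice p τ = ∑ s ∈ p.support, C (p.coeff s * τ ^ s 1) * X ^ s 0 := by
  rw [fstSlice, MvPolynomial.aeval_def, MvPolynomial.eval₂_eq']
  refine Finset.sum_congr rfl fun s _ => ?_
  simp [Fin.prod_univ_two]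
  ring

theorem sndSlice_eq_sum (p : MvPolynomial (Fin 2) ℂ) (ζ : ℂ) :
    sndSlice p ζ = ∑ s ∈ p.support, C (p.coeff s * ζ ^ s 0) * X ^ s 1 := by
  rw [sndSlice, MvPolynomial.aeval_def, MvPolynomial.eval₂_eq']
  refine Finset.sum_congr rfl fun s _ => ?_
  simp [Fin.prod_univ_two]
  ring

theorem MvPolynomial.eval_fin_two_eq_sum (p : MvPolynomial (Fin 2) ℂ) (z w : ℂ) :
    MvPolynomial.eval ![z, w] p = ∑ s ∈ p.support, p.coeff s * (z ^ s 0 * w ^ s 1) := by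
  rw [MvPolynomial.eval_eq']
  simp [Fin.prod_univ_two]

@[simp] theorem eval_fstSlice (p : MvPolynomial (Fin 2) ℂ) (τ z : ℂ) :
    (fstSlice p τ).eval z = MvPolynomial.eval ![z, τ] p := by
  rw [fstSlice_eq_sum, MvPolynomial.eval_fin_two_eq_sum, eval_finsetSum]
  refine Finset.sum_congr rfl fun s _ => ?_
  simp
  ring

@[simp] theorem eval_sndSlice (p : MvPolynomial (Fin 2) ℂ) (ζ z : ℂ) :
    (sndSlice p ζ).eval z = MvPolynomial.eval ![ζ, z] p := by
  rw [sndSlice_eq_sum, MvPolynomial.eval_fin_two_eq_sum, eval_finsetSum]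
  refine Finset.sum_congr rfl fun s _ => ?_
  simp
  ring

theorem natDegree_fstSlice_le {p : MvPolynomial (Fin 2) ℂ} {m : ℕ} (hm : p.degreeOf 0 ≤ m)
    (τ : ℂ) : (fstSlice p τ).natDegree ≤ m := by
  rw [fstSlice_eq_sum]
  refine natDegree_sum_le_of_forall_le _ _ fun s hs => (natDegree_C_mul_X_pow_le _ _).trans ?_
  exact MvPolynomial.degreeOf_le_iff.1 hm s hs

theorem natDegree_sndSlice_le {p : MvPolynomial (Fin 2) ℂ} {n : ℕ} (hn : p.degreeOf 1 ≤ n)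
    (ζ : ℂ) : (sndSlice p ζ).natDegree ≤ n := by
  rw [sndSlice_eq_sum]
  refine natDegree_sum_le_of_forall_le _ _ fun s hs => (natDegree_C_mul_X_pow_le _ _).trans ?_
  exact MvPolynomial.degreeOf_le_iff.1 hn s hs

theorem MvPolynomial.continuous_eval_fin_two (p : MvPolynomial (Fin 2) ℂ) :
    Continuous fun z : ℂ × ℂ => MvPolynomial.eval ![z.1, z.2] p :=
  (MvPolynomial.continuous_eval p).comp (by fun_prop)

/-- Inequalities between continuous functions pass from the disk to the closed disk. -/
theorem le_of_forall_norm_lt_one {f g : ℂ → ℝ} (hf : Continuous f) (hg : Continuous g)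
    (h : ∀ z : ℂ, ‖z‖ < 1 → f z ≤ g z) {z : ℂ} (hz : ‖z‖ ≤ 1) : f z ≤ g z := by
  have hcl : closure (Metric.ball (0 : ℂ) 1) ⊆ {z | f z ≤ g z} :=
    closure_minimal (fun z hz => h z (by simpa using hz)) (isClosed_le hf hg)
  rw [closure_ball _ one_ne_zero] at hcl
  exact hcl (by simpa using hz)

theorem infinite_unit_sphere : (Metric.sphere (0 : ℂ) 1).Infinite :=
  (isPreconnected_sphere (by simp [Complex.rank_real_complex]) 0 1).infinite_of_nontrivial
    ⟨1, by simp, -1, by simp, by norm_num⟩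

namespace IsRationalInner

variable {p : MvPolynomial (Fin 2) ℂ} {m n : ℕ}

theorem degreeOf_fst_le (hp : IsRationalInner p m n) : p.degreeOf 0 ≤ m :=
  (le_max_left _ _).trans_eq hp.degree_fst

theorem degreeOf_snd_le (hp : IsRationalInner p m n) : p.degreeOf 1 ≤ n :=
  (le_max_left _ _).trans_eq hp.degree_snd

theorem conj_inv_of_norm_eq_one {z : ℂ} (hz : ‖z‖ = 1) : (conj z)⁻¹ = z := by
  rw [← Complex.inv_eq_conj hz, inv_inv]

theorem norm_eval_reflectedPoly (hp : IsRationalInner p m n) {z τ : ℂ} (hz : ‖z‖ = 1)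
    (hτ : τ ≠ 0) :
    ‖MvPolynomial.eval ![z, τ] (reflectedPoly m n p)‖ =
      ‖τ‖ ^ n * ‖MvPolynomial.eval ![z, (conj τ)⁻¹] p‖ := by
  rw [eval_reflectedPoly hp.degreeOf_fst_le hp.degreeOf_snd_le
    (norm_ne_zero_iff.1 (by rw [hz]; exact one_ne_zero)) hτ, conj_inv_of_norm_eq_one hz]
  simp [hz]

/-- The constant in Harnack's inequality does not depend on `τ`, so the bound survives the passage
from `|τ| < 1` to `|τ| = 1`, where the slice may have zeros. It takes the place of Hurwitz's
theorem: a boundary slice with a zero in the open disk vanishes on the whole closed disk. -/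
theorem fstHarnack (hp : IsRationalInner p m n) {z z' τ : ℂ} (hz : ‖z‖ < 1) (hz' : ‖z'‖ ≤ 1)
    (hτ : ‖τ‖ ≤ 1) :
    ((1 - ‖z‖) / 2) ^ m * ‖MvPolynomial.eval ![z', τ] p‖ ≤ ‖MvPolynomial.eval ![z, τ] p‖ := by
  have hc := p.continuous_eval_fin_two
  refine le_of_forall_norm_lt_one
    (f := fun τ => ((1 - ‖z‖) / 2) ^ m * ‖MvPolynomial.eval ![z', τ] p‖)
    (g := fun τ => ‖MvPolynomial.eval ![z, τ] p‖)
    (continuous_const.mul (hc.comp (Continuous.prodMk_right z')).norm)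
    (hc.comp (Continuous.prodMk_right z)).norm (fun τ hτ => ?_) hτ
  simpa using Polynomial.norm_eval_harnack (natDegree_fstSlice_le hp.degreeOf_fst_le τ)
    (fun z hz => by simpa using hp.eval_ne_zero z τ hz hτ) hz hz'

theorem sndHarnack (hp : IsRationalInner p m n) {ζ z z' : ℂ} (hz : ‖z‖ < 1) (hz' : ‖z'‖ ≤ 1)
    (hζ : ‖ζ‖ ≤ 1) :
    ((1 - ‖z‖) / 2) ^ n * ‖MvPolynomial.eval ![ζ, z'] p‖ ≤ ‖MvPolynomial.eval ![ζ, z] p‖ := by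
  have hc := p.continuous_eval_fin_two
  refine le_of_forall_norm_lt_one
    (f := fun ζ => ((1 - ‖z‖) / 2) ^ n * ‖MvPolynomial.eval ![ζ, z'] p‖)
    (g := fun ζ => ‖MvPolynomial.eval ![ζ, z] p‖)
    (continuous_const.mul (hc.comp (Continuous.prodMk_left z')).norm)
    (hc.comp (Continuous.prodMk_left z)).norm (fun ζ hζ => ?_) hζ
  simpa using Polynomial.norm_eval_harnack (natDegree_sndSlice_le hp.degreeOf_snd_le ζ)
    (fun z hz => by simpa using hp.eval_ne_zero ζ z hζ hz) hz hz'

/-- On `𝕋 × 𝔻` the reflection of `p` is dominated by `p`. -/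
theorem norm_eval_reflectedPoly_le (hp : IsRationalInner p m n) {ζ z : ℂ} (hζ : ‖ζ‖ = 1)
    (hz0 : z ≠ 0) (hz : ‖z‖ ≤ 1) :
    ‖MvPolynomial.eval ![ζ, z] (reflectedPoly m n p)‖ ≤ ‖MvPolynomial.eval ![ζ, z] p‖ := by
  have hc := p.continuous_eval_fin_two
  rw [hp.norm_eval_reflectedPoly hζ hz0]
  -- For `ζ` inside the disk, `p(ζ, ·)` has no zeros in the disk and the one-variable bound applies;
  -- `ζ` is then moved to the circle.
  refine le_of_forall_norm_lt_one
    (f := fun ζ => ‖z‖ ^ n * ‖MvPolynomial.eval ![ζ, (conj z)⁻¹] p‖)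
    (g := fun ζ => ‖MvPolynomial.eval ![ζ, z] p‖)
    (continuous_const.mul (hc.comp (Continuous.prodMk_left _)).norm)
    (hc.comp (Continuous.prodMk_left z)).norm (fun ζ hζ => ?_) hζ.le
  simpa using Polynomial.norm_pow_mul_eval_inv_conj_le
    (natDegree_sndSlice_le hp.degreeOf_snd_le ζ)
    (fun z hz => by simpa using hp.eval_ne_zero ζ z hζ hz) hz0 hz

/-- The slices `p(·, τ)` outside of the exceptional set have no zeros in the closed disk. -/
theorem eval_ne_zero_of_notMem_exceptionalSet (hp : IsRationalInner p m n) {z τ : ℂ}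
    (hz : ‖z‖ ≤ 1) (hτ : ‖τ‖ = 1) (hE : τ ∉ exceptionalSet p) :
    MvPolynomial.eval ![z, τ] p ≠ 0 := by
  intro h0
  rcases hz.lt_or_eq with hz | hz
  -- A zero inside the disk forces a zero at the point `1` of the circle as well, which puts `τ`
  -- into the exceptional set.
  · have h := hp.fstHarnack hz (z' := 1) (by simp) hτ.le
    rw [h0, norm_zero] at h
    refine hE ⟨hτ, 1, by simp, norm_le_zero_iff.1 ?_⟩
    exact nonpos_of_mul_nonpos_right h (pow_pos (by linarith) _)
  · exact hE ⟨hτ, z, hz, h0⟩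

/-- There is a nonzero polynomial `r` in the second variable that is dominated by `p` on `𝕋 × 𝔻`
and vanishes on the exceptional set. -/
theorem exists_dominated (hp : IsRationalInner p m n) :
    ∃ r : ℂ[X], r ≠ 0 ∧ (∀ τ ∈ exceptionalSet p, r.eval τ = 0) ∧
      (∀ ζ z : ℂ, ‖ζ‖ = 1 → ‖z‖ < 1 → MvPolynomial.eval ![ζ, z] p ≠ 0) ∧
      ∃ K : ℝ, 0 ≤ K ∧ ∀ ζ z : ℂ, ‖ζ‖ = 1 → z ≠ 0 → ‖z‖ ≤ 1 →
        ‖r.eval z‖ ≤ K * ‖MvPolynomial.eval ![ζ, z] p‖ := by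
  obtain ⟨a, b, r, hr, hab⟩ := MvPolynomial.exists_eval_mul_add_mul_eq hp.isRelPrime
  have hne : ∀ z : ℂ, ‖z‖ = 1 → z ≠ 0 := fun z hz =>
    norm_ne_zero_iff.1 (by rw [hz]; exact one_ne_zero)
  -- On `𝕋²` one has `|p̃| = |p|`, so a zero of `p` there is a common zero and annihilates `r = a p
  -- + b p̃`.
  have hvan : ∀ ζ τ : ℂ, ‖ζ‖ = 1 → ‖τ‖ = 1 → MvPolynomial.eval ![ζ, τ] p = 0 →
      r.eval τ = 0 := by
    intro ζ τ hζ hτ h0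
    have h1 := hp.norm_eval_reflectedPoly hζ (hne τ hτ)
    rw [conj_inv_of_norm_eq_one hτ, h0, norm_zero, mul_zero, norm_eq_zero] at h1
    rw [← hab ζ τ, h0, h1]
    simp
  refine ⟨r, hr, fun τ ⟨hτ, ζ, hζ, h0⟩ => hvan ζ τ hζ hτ h0, fun ζ z hζ hz h0 => hr ?_, ?_⟩
  -- A zero of `p(ζ, ·)` inside the disk makes it vanish on all of `𝕋` by Harnack, and then `r`
  -- would have infinitely many roots.
  · refine eq_zero_of_infinite_isRoot r (infinite_unit_sphere.mono fun τ hτ => ?_)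
    have hτ : ‖τ‖ = 1 := by simpa using hτ
    have h := hp.sndHarnack hz (z' := τ) hτ.le hζ.le
    rw [h0, norm_zero] at h
    exact hvan ζ τ hζ hτ (norm_le_zero_iff.1
      (nonpos_of_mul_nonpos_right h (pow_pos (by linarith) _)))
  · have hbd : ∀ f : MvPolynomial (Fin 2) ℂ, ∃ A : ℝ, 0 ≤ A ∧ ∀ ζ z : ℂ, ‖ζ‖ ≤ 1 → ‖z‖ ≤ 1 →
        ‖MvPolynomial.eval ![ζ, z] f‖ ≤ A := by
      intro f
      obtain ⟨A, hA⟩ := ((isCompact_closedBall (0 : ℂ) 1).prod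
        (isCompact_closedBall (0 : ℂ) 1)).exists_bound_of_continuousOn
          f.continuous_eval_fin_two.continuousOn
      have h : ∀ ζ z : ℂ, ‖ζ‖ ≤ 1 → ‖z‖ ≤ 1 → ‖MvPolynomial.eval ![ζ, z] f‖ ≤ A :=
        fun ζ z hζ hz => hA (ζ, z) ⟨by simpa using hζ, by simpa using hz⟩
      exact ⟨A, (norm_nonneg _).trans (h 0 0 (by simp) (by simp)), h⟩
    obtain ⟨A, hA0, hA⟩ := hbd a
    obtain ⟨B, hB0, hB⟩ := hbd b
    -- The constant is the sum of bounds of `a` and `b` on the closed bidisk, because `|p̃| ≤ |p|`.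
    refine ⟨A + B, by positivity, fun ζ z hζ hz0 hz => ?_⟩
    rw [← hab ζ z, add_mul]
    refine (norm_add_le _ _).trans ?_
    rw [norm_mul, norm_mul]
    gcongr
    · exact hA ζ z hζ.le hz
    · exact hB ζ z hζ.le hz
    · exact hp.norm_eval_reflectedPoly_le hζ hz0 hz

theorem finite_exceptionalSet (hp : IsRationalInner p m n) : (exceptionalSet p).Finite := by
  obtain ⟨r, hr, hE, -⟩ := hp.exists_dominated
  exact (finite_setOfPred_isRoot hr).subset hE

end IsRationalInner

end Slices

/-! ### Square-summable families -/

section SquareSummable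

variable {ι : Type*}

theorem reindexIsometry_apply (e : ι ↪ ι) (f : lp (fun _ : ι => ℂ) 2) (i : ι) :
    reindexIsometry e f (e i) = f i :=
  e.injective.extend_apply f 0 i

theorem reindexIsometry_apply_of_notMem_range (e : ι ↪ ι) (f : lp (fun _ : ι => ℂ) 2) {j : ι}
    (hj : j ∉ Set.range e) : reindexIsometry e f j = 0 :=
  Function.extend_apply' (f := e) (f : ι → ℂ) 0 j (by simpa using hj)

theorem reindexIsometry_single [DecidableEq ι] (e : ι ↪ ι) (i : ι) (c : ℂ) :
    reindexIsometry e (lp.single 2 i c) = lp.single 2 (e i) c := by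
  ext j
  by_cases hj : j ∈ Set.range e
  · obtain ⟨k, rfl⟩ := hj
    rw [reindexIsometry_apply]
    by_cases hk : k = i
    · subst hk
      simp
    · rw [lp.single_apply_ne _ _ _ hk, lp.single_apply_ne _ _ _ (e.injective.ne hk)]
  · rw [reindexIsometry_apply_of_notMem_range _ _ hj, lp.single_apply_ne]
    rintro rfl
    exact hj ⟨i, rfl⟩

theorem tsum_reindexIsometry_mul (e : ι ↪ ι) (f : lp (fun _ : ι => ℂ) 2) (g : ι → ℂ) :
    ∑' j, reindexIsometry e f j * g j = ∑' i, f i * g (e i) := by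
  rw [← e.injective.tsum_eq]
  · simp only [reindexIsometry_apply]
  · intro j hj
    by_contra hj'
    exact hj (by simp [reindexIsometry_apply_of_notMem_range e f hj'])

/-- Continuous linear maps on `ℓ²` that agree on the standard basis are equal. -/
theorem lp_two_clm_ext [DecidableEq ι] {E : Type*} [AddCommGroup E] [Module ℂ E]
    [TopologicalSpace E] [T2Space E] {A B : lp (fun _ : ι => ℂ) 2 →L[ℂ] E}
    (h : ∀ i, A (lp.single 2 i 1) = B (lp.single 2 i 1)) : A = B := by
  ext f
  have hs : ∀ i, lp.single 2 i (f i) = f i • lp.single (E := fun _ : ι => ℂ) 2 i (1 : ℂ) := by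
    intro i
    rw [← lp.single_smul, smul_eq_mul, mul_one]
  have hf := lp.hasSum_single (p := 2) (by simp) f
  have hA := A.hasSum hf
  have hB := B.hasSum hf
  simp only [hs, map_smul, h] at hA hB
  exact hA.unique hB

/-- A vanishing power series with bounded coefficients has vanishing coefficients. -/
theorem eq_zero_of_tsum_mul_pow_eq_zero {a : ℕ → ℂ} {M : ℝ} (ha : ∀ k, ‖a k‖ ≤ M)
    (h : ∀ z : ℂ, ‖z‖ < 1 → ∑' k, a k * z ^ k = 0) : a = 0 := by
  have hrad : 1 ≤ (FormalMultilinearSeries.ofScalars ℂ a).radius := by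
    refine FormalMultilinearSeries.le_radius_of_bound (r := 1) _ M fun k => ?_
    simpa using ha k
  have hball := (FormalMultilinearSeries.ofScalars ℂ a).hasFPowerSeriesOnBall
    (zero_lt_one.trans_le hrad)
  have hzero : HasFPowerSeriesAt (0 : ℂ → ℂ) (FormalMultilinearSeries.ofScalars ℂ a) 0 := by
    refine hball.hasFPowerSeriesAt.congr ?_
    filter_upwards [Metric.ball_mem_nhds (0 : ℂ) one_pos] with z hz
    exact ((FormalMultilinearSeries.ofScalars_sum_eq a z).trans
      (by simpa using h z (by simpa using hz)))
  have := hzero.eq_zero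
  rwa [FormalMultilinearSeries.ofScalars_series_eq_zero] at this

end SquareSummable

/-! ### Values, coefficients and the shift on the Hardy space of the disk -/

namespace H2Disk

/-- The constant function `1`. -/
def one : H2Disk := lp.single 2 0 1

theorem norm_coeff_le (f : H2Disk) (k : ℕ) : ‖f k‖ ≤ ‖f‖ := lp.norm_apply_le_norm (by simp) f k

theorem norm_eval_le (f : H2Disk) {z : ℂ} (hz : ‖z‖ < 1) :
    ‖f.eval z‖ ≤ (1 - ‖z‖)⁻¹ * ‖f‖ := by
  refine tsum_of_norm_bounded ((hasSum_geometric_of_lt_one (norm_nonneg _) hz).mul_right ‖f‖)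
    fun k => ?_
  rw [norm_mul, norm_pow, mul_comm]
  gcongr
  exact f.norm_coeff_le k

/-- Evaluation at a point of the disk as a continuous linear form. -/
def evalCLM (z : ℂ) (hz : ‖z‖ < 1) : H2Disk →L[ℂ] ℂ :=
  LinearMap.mkContinuous
    { toFun := fun f => f.eval z
      map_add' := fun f g => by
        simp only [eval]
        rw [← (f.summable_eval hz).tsum_add (g.summable_eval hz)]
        simp [add_mul]
      map_smul' := fun c f => by simp [eval, mul_assoc, tsum_mul_left] }
    _ fun f => f.norm_eval_le hz

@[simp] theorem evalCLM_apply (z : ℂ) (hz : ‖z‖ < 1) (f : H2Disk) :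
    evalCLM z hz f = f.eval z := rfl

/-- This reduces identities between vectors of `H²(𝔻)` to identities between numbers at each point
of the disk. -/
theorem ext_eval {f g : H2Disk} (h : ∀ z : ℂ, ‖z‖ < 1 → f.eval z = g.eval z) : f = g := by
  rw [← sub_eq_zero]
  refine lp.ext (eq_zero_of_tsum_mul_pow_eq_zero (M := ‖f - g‖) (f - g).norm_coeff_le
    fun z hz => ?_)
  change (f - g).eval z = 0
  rw [← evalCLM_apply z hz, map_sub, evalCLM_apply, evalCLM_apply, h z hz, sub_self]

theorem eval_shift (f : H2Disk) (z : ℂ) : (shift f).eval z = z * f.eval z := by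
  refine (tsum_reindexIsometry_mul _ f fun k => z ^ k).trans ?_
  rw [eval, ← tsum_mul_left]
  refine tsum_congr fun k => ?_
  change f k * z ^ (k + 1) = z * (f k * z ^ k)
  ring

@[simp] theorem eval_one (z : ℂ) : one.eval z = 1 := by
  rw [eval, tsum_eq_single 0]
  · simp [one]
  · intro k hk
    rw [one, lp.single_apply_ne _ _ _ hk, zero_mul]

theorem eval_aeval_shift (q : ℂ[X]) (f : H2Disk) {z : ℂ} (hz : ‖z‖ < 1) :
    (Polynomial.aeval shift q f).eval z = q.eval z * f.eval z := by
  induction q using Polynomial.induction_on' with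
  | add q r hq hr =>
    rw [map_add, add_apply, ← evalCLM_apply z hz, map_add, evalCLM_apply,
      evalCLM_apply, hq, hr, Polynomial.eval_add, add_mul]
  | monomial k c =>
    have hk : ∀ k : ℕ, ((shift ^ k) f).eval z = z ^ k * f.eval z := by
      intro k
      induction k with
      | zero => simp
      | succ k ih => rw [pow_succ', mul_apply_eq_comp, eval_shift, ih]; ring
    rw [Polynomial.aeval_monomial, ← Algebra.smul_def, smul_apply,
      ← evalCLM_apply z hz, map_smul, evalCLM_apply, hk, Polynomial.eval_monomial, smul_eq_mul,
      mul_assoc]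

theorem shift_single (k : ℕ) (c : ℂ) : shift (lp.single 2 k c) = lp.single 2 (k + 1) c :=
  reindexIsometry_single _ k c

theorem shift_pow_one (k : ℕ) : (shift ^ k) one = lp.single 2 k 1 := by
  induction k with
  | zero => rfl
  | succ k ih => rw [pow_succ', mul_apply_eq_comp, ih, shift_single]

theorem shift_apply_succ (f : H2Disk) (k : ℕ) : shift f (k + 1) = f k :=
  reindexIsometry_apply _ f k

theorem shift_apply_zero (f : H2Disk) : shift f 0 = 0 :=
  reindexIsometry_apply_of_notMem_range _ f (by simp)

theorem shift_pow_apply (a : ℕ) (f : H2Disk) (k : ℕ) :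
    (shift ^ a) f k = if a ≤ k then f (k - a) else 0 := by
  induction a generalizing k with
  | zero => simp
  | succ a ih =>
    rw [pow_succ', mul_apply_eq_comp]
    cases k with
    | zero => simp [shift_apply_zero]
    | succ k =>
      simp only [shift_apply_succ, ih, Nat.add_le_add_iff_right, Nat.add_sub_add_right]

theorem inner_shift_pow_one (k : ℕ) (f : H2Disk) : inner ℂ ((shift ^ k) one) f = f k := by
  rw [shift_pow_one, lp.inner_single_left]
  simp

theorem norm_shift (f : H2Disk) : ‖shift f‖ = ‖f‖ := LinearIsometry.norm_map _ f

theorem norm_one_eq : ‖one‖ = 1 := by simp [one]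

theorem clm_ext {E : Type*} [AddCommGroup E] [Module ℂ E]
    [TopologicalSpace E] [T2Space E] {A B : H2Disk →L[ℂ] E}
    (h : ∀ k : ℕ, A ((shift ^ k) one) = B ((shift ^ k) one)) : A = B :=
  lp_two_clm_ext fun k => by simpa only [shift_pow_one] using h k

end H2Disk

/-! ### Values, coefficients and polynomial multiplication on the Hardy space of the bidisk -/

namespace H2Bidisk

/-- The constant function `1`. -/
def one : H2Bidisk := lp.single 2 (0, 0) 1

theorem norm_coeff_le (f : H2Bidisk) (k : ℕ × ℕ) : ‖f k‖ ≤ ‖f‖ :=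
  lp.norm_apply_le_norm (by simp) f k

theorem norm_eval_le (f : H2Bidisk) {z₁ z₂ : ℂ} (h₁ : ‖z₁‖ < 1) (h₂ : ‖z₂‖ < 1) :
    ‖f.eval z₁ z₂‖ ≤ (∑' k : ℕ × ℕ, ‖z₁‖ ^ k.1 * ‖z₂‖ ^ k.2) * ‖f‖ := by
  have hs : Summable fun k : ℕ × ℕ => ‖z₁‖ ^ k.1 * ‖z₂‖ ^ k.2 :=
    (summable_geometric_of_lt_one (norm_nonneg _) h₁).mul_of_nonneg
      (summable_geometric_of_lt_one (norm_nonneg _) h₂)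
      (fun _ => by positivity) (fun _ => by positivity)
  refine tsum_of_norm_bounded (hs.hasSum.mul_right ‖f‖) fun k => ?_
  rw [norm_mul, norm_mul, norm_pow, norm_pow, mul_comm]
  gcongr
  exact f.norm_coeff_le k

/-- Evaluation at a point of the bidisk as a continuous linear form. -/
def evalCLM (z₁ z₂ : ℂ) (h₁ : ‖z₁‖ < 1) (h₂ : ‖z₂‖ < 1) : H2Bidisk →L[ℂ] ℂ :=
  LinearMap.mkContinuous
    { toFun := fun f => f.eval z₁ z₂
      map_add' := fun f g => by
        simp only [eval]
        rw [← (f.summable_eval h₁ h₂).tsum_add (g.summable_eval h₁ h₂)]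
        simp [add_mul]
      map_smul' := fun c f => by simp [eval, mul_assoc, tsum_mul_left] }
    _ fun f => f.norm_eval_le h₁ h₂

@[simp] theorem evalCLM_apply (z₁ z₂ : ℂ) (h₁ : ‖z₁‖ < 1) (h₂ : ‖z₂‖ < 1) (f : H2Bidisk) :
    evalCLM z₁ z₂ h₁ h₂ f = f.eval z₁ z₂ := rfl

theorem norm_tsum_snd_le (f : H2Bidisk) (j : ℕ) {z : ℂ} (hz : ‖z‖ < 1) :
    ‖∑' k, f (j, k) * z ^ k‖ ≤ (1 - ‖z‖)⁻¹ * ‖f‖ := by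
  refine tsum_of_norm_bounded ((hasSum_geometric_of_lt_one (norm_nonneg _) hz).mul_right ‖f‖)
    fun k => ?_
  rw [norm_mul, norm_pow, mul_comm]
  gcongr
  exact f.norm_coeff_le _

theorem eval_eq_tsum_tsum (f : H2Bidisk) {z₁ z₂ : ℂ} (h₁ : ‖z₁‖ < 1) (h₂ : ‖z₂‖ < 1) :
    f.eval z₁ z₂ = ∑' j, (∑' k, f (j, k) * z₂ ^ k) * z₁ ^ j := by
  rw [eval, (f.summable_eval h₁ h₂).tsum_prod]
  refine tsum_congr fun j => ?_
  rw [← tsum_mul_right]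
  refine tsum_congr fun k => ?_
  ring

/-- One variable at a time: for fixed `z₂` the coefficients of `z₁ʲ` vanish, and these are in turn
power series in `z₂`. -/
theorem ext_eval {f g : H2Bidisk}
    (h : ∀ z₁ z₂ : ℂ, ‖z₁‖ < 1 → ‖z₂‖ < 1 → f.eval z₁ z₂ = g.eval z₁ z₂) : f = g := by
  rw [← sub_eq_zero]
  have h0 : ∀ z₁ z₂ : ℂ, ‖z₁‖ < 1 → ‖z₂‖ < 1 → (f - g).eval z₁ z₂ = 0 := by
    intro z₁ z₂ h₁ h₂
    rw [← evalCLM_apply z₁ z₂ h₁ h₂, map_sub, evalCLM_apply, evalCLM_apply, h z₁ z₂ h₁ h₂,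
      sub_self]
  refine lp.ext (funext fun ⟨j, k⟩ => ?_)
  have hj : ∀ z : ℂ, ‖z‖ < 1 → ∀ j, ∑' k, (f - g) (j, k) * z ^ k = 0 := by
    intro z hz j
    have := eq_zero_of_tsum_mul_pow_eq_zero (a := fun j => ∑' k, (f - g) (j, k) * z ^ k)
      (fun j => (f - g).norm_tsum_snd_le j hz) fun w hw => by
        rw [← eval_eq_tsum_tsum _ hw hz, h0 w z hw hz]
    exact congrFun this j
  exact congrFun (eq_zero_of_tsum_mul_pow_eq_zero (a := fun k => (f - g) (j, k))
    (fun k => (f - g).norm_coeff_le _) fun z hz => hj z hz j) k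

theorem eval_shift₁ (f : H2Bidisk) (z₁ z₂ : ℂ) : (shift₁ f).eval z₁ z₂ = z₁ * f.eval z₁ z₂ := by
  refine (tsum_reindexIsometry_mul _ f fun k : ℕ × ℕ => z₁ ^ k.1 * z₂ ^ k.2).trans ?_
  rw [eval, ← tsum_mul_left]
  refine tsum_congr fun k => ?_
  change f k * (z₁ ^ (k.1 + 1) * z₂ ^ k.2) = z₁ * (f k * (z₁ ^ k.1 * z₂ ^ k.2))
  ring

theorem eval_shift₂ (f : H2Bidisk) (z₁ z₂ : ℂ) : (shift₂ f).eval z₁ z₂ = z₂ * f.eval z₁ z₂ := by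
  refine (tsum_reindexIsometry_mul _ f fun k : ℕ × ℕ => z₁ ^ k.1 * z₂ ^ k.2).trans ?_
  rw [eval, ← tsum_mul_left]
  refine tsum_congr fun k => ?_
  change f k * (z₁ ^ k.1 * z₂ ^ (k.2 + 1)) = z₂ * (f k * (z₁ ^ k.1 * z₂ ^ k.2))
  ring

theorem eval_shift₁_pow (a : ℕ) (f : H2Bidisk) (z₁ z₂ : ℂ) :
    ((shift₁ ^ a) f).eval z₁ z₂ = z₁ ^ a * f.eval z₁ z₂ := by
  induction a with
  | zero => simp
  | succ a ih => rw [pow_succ', mul_apply_eq_comp, eval_shift₁, ih]; ring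

theorem eval_shift₂_pow (a : ℕ) (f : H2Bidisk) (z₁ z₂ : ℂ) :
    ((shift₂ ^ a) f).eval z₁ z₂ = z₂ ^ a * f.eval z₁ z₂ := by
  induction a with
  | zero => simp
  | succ a ih => rw [pow_succ', mul_apply_eq_comp, eval_shift₂, ih]; ring

theorem shift₁_single (k : ℕ × ℕ) (c : ℂ) :
    shift₁ (lp.single 2 k c) = lp.single 2 (k.1 + 1, k.2) c :=
  reindexIsometry_single _ k c

theorem shift₂_single (k : ℕ × ℕ) (c : ℂ) :
    shift₂ (lp.single 2 k c) = lp.single 2 (k.1, k.2 + 1) c :=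
  reindexIsometry_single _ k c

theorem shift_pow_one (j k : ℕ) : (shift₁ ^ j) ((shift₂ ^ k) one) = lp.single 2 (j, k) 1 := by
  induction j with
  | zero =>
    induction k with
    | zero => rfl
    | succ k ih =>
      rw [pow_zero, one_apply_eq_self] at ih ⊢
      rw [pow_succ', mul_apply_eq_comp, ih, shift₂_single]
  | succ j ih => rw [pow_succ', mul_apply_eq_comp, ih, shift₁_single]

@[simp] theorem eval_one (z₁ z₂ : ℂ) : one.eval z₁ z₂ = 1 := by
  rw [eval, tsum_eq_single (0, 0)]
  · simp [one]
  · intro k hk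
    rw [one, lp.single_apply_ne _ _ _ hk, zero_mul]

theorem norm_shift₁ (f : H2Bidisk) : ‖shift₁ f‖ = ‖f‖ := LinearIsometry.norm_map _ f

theorem norm_shift₂ (f : H2Bidisk) : ‖shift₂ f‖ = ‖f‖ := LinearIsometry.norm_map _ f

theorem shift₁_pow_apply (a : ℕ) (f : H2Bidisk) (j k : ℕ) :
    (shift₁ ^ a) f (j, k) = if a ≤ j then f (j - a, k) else 0 := by
  induction a generalizing j with
  | zero => simp
  | succ a ih =>
    rw [pow_succ', mul_apply_eq_comp]
    cases j with
    | zero =>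
      rw [if_neg (by omega)]
      refine reindexIsometry_apply_of_notMem_range _ _ ?_
      rintro ⟨⟨x, y⟩, h⟩
      simp [Prod.ext_iff] at h
    | succ j =>
      refine (reindexIsometry_apply _ _ (j, k)).trans ?_
      simp only [ih, Nat.add_le_add_iff_right, Nat.add_sub_add_right]

theorem shift₂_pow_apply (a : ℕ) (f : H2Bidisk) (j k : ℕ) :
    (shift₂ ^ a) f (j, k) = if a ≤ k then f (j, k - a) else 0 := by
  induction a generalizing k with
  | zero => simp
  | succ a ih =>
    rw [pow_succ', mul_apply_eq_comp]
    cases k with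
    | zero =>
      rw [if_neg (by omega)]
      refine reindexIsometry_apply_of_notMem_range _ _ ?_
      rintro ⟨⟨x, y⟩, h⟩
      simp [Prod.ext_iff] at h
    | succ k =>
      refine (reindexIsometry_apply _ _ (j, k)).trans ?_
      simp only [ih, Nat.add_le_add_iff_right, Nat.add_sub_add_right]

theorem inner_shift_pow_one (j k : ℕ) (f : H2Bidisk) :
    inner ℂ ((shift₁ ^ j) ((shift₂ ^ k) one)) f = f (j, k) := by
  rw [shift_pow_one, lp.inner_single_left]
  simp

theorem clm_ext {E : Type*} [AddCommGroup E] [Module ℂ E]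
    [TopologicalSpace E] [T2Space E] {A B : H2Bidisk →L[ℂ] E}
    (h : ∀ j k : ℕ, A ((shift₁ ^ j) ((shift₂ ^ k) one)) = B ((shift₁ ^ j) ((shift₂ ^ k) one))) :
    A = B :=
  lp_two_clm_ext fun ⟨j, k⟩ => by simpa only [shift_pow_one] using h j k

/-- Multiplication by a polynomial on `H²(𝔻²)`. -/
def polyMul (p : MvPolynomial (Fin 2) ℂ) : H2Bidisk →L[ℂ] H2Bidisk :=
  ∑ s ∈ p.support, p.coeff s • (shift₁ ^ s 0 * shift₂ ^ s 1)

theorem polyMul_apply (p : MvPolynomial (Fin 2) ℂ) (f : H2Bidisk) :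
    polyMul p f = ∑ s ∈ p.support, p.coeff s • (shift₁ ^ s 0) ((shift₂ ^ s 1) f) := by
  simp [polyMul]

theorem eval_polyMul (p : MvPolynomial (Fin 2) ℂ) (f : H2Bidisk) {z₁ z₂ : ℂ} (h₁ : ‖z₁‖ < 1)
    (h₂ : ‖z₂‖ < 1) :
    (polyMul p f).eval z₁ z₂ = MvPolynomial.eval ![z₁, z₂] p * f.eval z₁ z₂ := by
  rw [polyMul_apply, ← evalCLM_apply z₁ z₂ h₁ h₂, map_sum, MvPolynomial.eval_fin_two_eq_sum,
    Finset.sum_mul]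
  refine Finset.sum_congr rfl fun s _ => ?_
  rw [map_smul, evalCLM_apply, eval_shift₁_pow, eval_shift₂_pow, smul_eq_mul]
  ring

theorem eval_aeval_shift₁ (q : ℂ[X]) (f : H2Bidisk) {z₁ z₂ : ℂ} (h₁ : ‖z₁‖ < 1)
    (h₂ : ‖z₂‖ < 1) :
    (Polynomial.aeval shift₁ q f).eval z₁ z₂ = q.eval z₁ * f.eval z₁ z₂ := by
  induction q using Polynomial.induction_on' with
  | add q r hq hr =>
    rw [map_add, add_apply, ← evalCLM_apply _ _ h₁ h₂, map_add, evalCLM_apply,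
      evalCLM_apply, hq, hr, Polynomial.eval_add, add_mul]
  | monomial k c =>
    rw [Polynomial.aeval_monomial, ← Algebra.smul_def, smul_apply,
      ← evalCLM_apply _ _ h₁ h₂, map_smul, evalCLM_apply, eval_shift₁_pow,
      Polynomial.eval_monomial, smul_eq_mul, mul_assoc]

theorem eval_aeval_shift₂ (q : ℂ[X]) (f : H2Bidisk) {z₁ z₂ : ℂ} (h₁ : ‖z₁‖ < 1)
    (h₂ : ‖z₂‖ < 1) :
    (Polynomial.aeval shift₂ q f).eval z₁ z₂ = q.eval z₂ * f.eval z₁ z₂ := by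
  induction q using Polynomial.induction_on' with
  | add q r hq hr =>
    rw [map_add, add_apply, ← evalCLM_apply _ _ h₁ h₂, map_add, evalCLM_apply,
      evalCLM_apply, hq, hr, Polynomial.eval_add, add_mul]
  | monomial k c =>
    rw [Polynomial.aeval_monomial, ← Algebra.smul_def, smul_apply,
      ← evalCLM_apply _ _ h₁ h₂, map_smul, evalCLM_apply, eval_shift₂_pow,
      Polynomial.eval_monomial, smul_eq_mul, mul_assoc]

theorem polyMul_shift₁_pow (p : MvPolynomial (Fin 2) ℂ) (a : ℕ) (f : H2Bidisk) :
    polyMul p ((shift₁ ^ a) f) = (shift₁ ^ a) (polyMul p f) :=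
  ext_eval fun z₁ z₂ h₁ h₂ => by
    rw [eval_polyMul _ _ h₁ h₂, eval_shift₁_pow, eval_shift₁_pow, eval_polyMul _ _ h₁ h₂]
    ring

theorem polyMul_shift₂_pow (p : MvPolynomial (Fin 2) ℂ) (a : ℕ) (f : H2Bidisk) :
    polyMul p ((shift₂ ^ a) f) = (shift₂ ^ a) (polyMul p f) :=
  ext_eval fun z₁ z₂ h₁ h₂ => by
    rw [eval_polyMul _ _ h₁ h₂, eval_shift₂_pow, eval_shift₂_pow, eval_polyMul _ _ h₁ h₂]
    ring

/-- Indexing by the support of `p` rather than that of its reflection allows a term-by-term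
comparison with `polyMul p`. -/
theorem polyMul_reflectedPoly (m n : ℕ) (p : MvPolynomial (Fin 2) ℂ) (f : H2Bidisk) :
    polyMul (reflectedPoly m n p) f =
      ∑ s ∈ p.support, conj (p.coeff s) • (shift₁ ^ (m - s 0)) ((shift₂ ^ (n - s 1)) f) := by
  refine ext_eval fun z₁ z₂ h₁ h₂ => ?_
  rw [eval_polyMul _ _ h₁ h₂, ← evalCLM_apply z₁ z₂ h₁ h₂ (∑ s ∈ p.support, _), map_sum,
    reflectedPoly, map_sum, Finset.sum_mul]
  refine Finset.sum_congr rfl fun s _ => ?_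
  rw [map_smul, evalCLM_apply, eval_shift₁_pow, eval_shift₂_pow, smul_eq_mul,
    MvPolynomial.eval_monomial, Finsupp.prod_fintype _ _ (by simp)]
  simp [Fin.prod_univ_two]
  ring

/-- The coefficients of `p f` of large index are inner products with multiples of the reflection
of `p`. -/
theorem inner_polyMul_reflectedPoly {m n : ℕ} {p : MvPolynomial (Fin 2) ℂ}
    (hm : p.degreeOf 0 ≤ m) (hn : p.degreeOf 1 ≤ n) (a b : ℕ) (f : H2Bidisk) :
    inner ℂ (polyMul (reflectedPoly m n p) ((shift₁ ^ a) ((shift₂ ^ b) one))) f =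
      polyMul p f (m + a, n + b) := by
  rw [polyMul_reflectedPoly, polyMul_apply, sum_inner, lp.coeFn_sum, Finset.sum_apply]
  refine Finset.sum_congr rfl fun s hs => ?_
  have hs0 : s 0 ≤ m := (MvPolynomial.degreeOf_le_iff.1 hm) s hs
  have hs1 : s 1 ≤ n := (MvPolynomial.degreeOf_le_iff.1 hn) s hs
  -- The reflected monomial reads off the coefficient of `f` at `(m - s 0 + a, n - s 1 + b)`, which
  -- is the one that the monomial `s` of `p` moves to `(m + a, n + b)`.
  have hcomm : (shift₁ ^ (m - s 0)) ((shift₂ ^ (n - s 1)) ((shift₁ ^ a) ((shift₂ ^ b) one))) =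
      (shift₁ ^ (m - s 0 + a)) ((shift₂ ^ (n - s 1 + b)) one) :=
    ext_eval fun z₁ z₂ _ _ => by simp only [eval_shift₁_pow, eval_shift₂_pow]; ring
  rw [hcomm, inner_smul_left, inner_shift_pow_one, lp.coeFn_smul, Pi.smul_apply,
    shift₁_pow_apply, if_pos (by omega), shift₂_pow_apply, if_pos (by omega), Complex.conj_conj,
    smul_eq_mul, show m + a - s 0 = m - s 0 + a by omega, show n + b - s 1 = n - s 1 + b by omega]

end H2Bidisk

/-! ### Fourier series on the circle -/

section Circle

open AddCircle

/-- The normalized Haar measure of the circle. -/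
abbrev circleHaar : Measure UnitAddCircle := haarAddCircle

/-- The parametrization of the unit circle by `ℝ / ℤ`. -/
def circleExp (t : UnitAddCircle) : ℂ := (toCircle t : ℂ)

@[simp] theorem norm_circleExp (t : UnitAddCircle) : ‖circleExp t‖ = 1 := Circle.norm_coe _

theorem continuous_circleExp : Continuous circleExp :=
  (fourier (T := 1) 1).continuous.congr fun _ => fourier_one

theorem circleExp_injective : Function.Injective circleExp :=
  Circle.coe_injective.comp (injective_toCircle one_ne_zero)

theorem exists_circleExp_eq {τ : ℂ} (hτ : ‖τ‖ = 1) : ∃ t, circleExp t = τ := by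
  obtain ⟨t, ht⟩ := (homeomorphCircle (T := 1) one_ne_zero).surjective ⟨τ, mem_sphere_zero_iff_norm.2 hτ⟩
  exact ⟨t, by rw [circleExp, ← homeomorphCircle_apply one_ne_zero, ht]⟩

theorem fourier_natCast (k : ℕ) (t : UnitAddCircle) :
    fourier (k : ℤ) t = circleExp t ^ k := by
  rw [fourier_apply, circleExp, ← Circle.coe_pow, ← toCircle_nsmul, natCast_zsmul]

theorem integral_conj_circleExp_pow_mul (k l : ℕ) :
    ∫ t, conj (circleExp t ^ k) * circleExp t ^ l ∂circleHaar = if k = l then 1 else 0 := by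
  have h := orthonormal_iff_ite.1 (orthonormal_fourier (T := 1)) k l
  rw [ContinuousMap.inner_toLp] at h
  simp only [Nat.cast_inj, fourier_natCast] at h
  simpa only [mul_comm] using h

/-- Parseval's identity for trigonometric polynomials with values in an inner product space. -/
theorem integral_norm_sum_circleExp_pow_smul_sq {H : Type*} [NormedAddCommGroup H]
    [InnerProductSpace ℂ H] (s : Finset ℕ) (a : ℕ → H) :
    ∫ t, ‖∑ k ∈ s, circleExp t ^ k • a k‖ ^ 2 ∂circleHaar = ∑ k ∈ s, ‖a k‖ ^ 2 := by
  have hint : ∀ k l : ℕ, Integrable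
      (fun t => conj (circleExp t ^ k) * circleExp t ^ l * inner ℂ (a k) (a l)) circleHaar := by
    intro k l
    refine Continuous.integrable_of_hasCompactSupport ?_ (HasCompactSupport.of_compactSpace _)
    have := continuous_circleExp
    fun_prop
  have h : ∀ t, ((‖∑ k ∈ s, circleExp t ^ k • a k‖ ^ 2 : ℝ) : ℂ) = ∑ k ∈ s, ∑ l ∈ s,
      conj (circleExp t ^ k) * circleExp t ^ l * inner ℂ (a k) (a l) := by
    intro t
    have h := inner_self_eq_norm_sq_to_K (𝕜 := ℂ) (∑ k ∈ s, circleExp t ^ k • a k)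
    rw [RCLike.ofReal_eq_complex_ofReal] at h
    rw [Complex.ofReal_pow, ← h, sum_inner]
    refine Finset.sum_congr rfl fun k _ => ?_
    rw [inner_sum]
    refine Finset.sum_congr rfl fun l _ => ?_
    rw [inner_smul_left, inner_smul_right]
    ring
  apply Complex.ofReal_injective
  rw [← integral_complex_ofReal]
  simp only [h]
  rw [integral_finsetSum _ fun k _ => integrable_finsetSum _ fun l _ => hint k l,
    Complex.ofReal_sum]
  refine Finset.sum_congr rfl fun k hk => ?_
  rw [integral_finsetSum _ fun l _ => hint k l]
  simp only [integral_mul_const, integral_conj_circleExp_pow_mul]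
  rw [Finset.sum_eq_single k (fun l _ hl => by simp [hl.symm]) (fun h => absurd hk h)]
  simp [inner_self_eq_norm_sq_to_K]

end Circle

/-! ### Polynomials of the unilateral shift -/

namespace H2Disk

open Polynomial

theorem opNorm_shift_le : ‖shift‖ ≤ 1 :=
  ContinuousLinearMap.opNorm_le_bound _ zero_le_one fun f => by rw [norm_shift, one_mul]

/-- The spectrum of a contraction lies in the closed disk, and by spectral mapping that of
`q(shift)` consists of values of `q` there. -/
theorem isUnit_aeval_shift {q : ℂ[X]} (hq : ∀ z : ℂ, ‖z‖ ≤ 1 → q.eval z ≠ 0) :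
    IsUnit (aeval shift q) := by
  have : Nontrivial H2Disk := ⟨one, 0, fun h => by simpa [h] using norm_one_eq⟩
  rw [← spectrum.zero_notMem_iff ℂ, spectrum.map_polynomial_aeval]
  rintro ⟨z, hz, h0⟩
  exact hq z ((spectrum.norm_le_norm_of_mem hz).trans opNorm_shift_le) h0

theorem aeval_shift_one_apply (q : ℂ[X]) (k : ℕ) : aeval shift q one k = q.coeff k := by
  rw [aeval_eq_sum_range, sum_apply, lp.coeFn_sum, Finset.sum_apply]
  simp only [smul_apply, shift_pow_one, lp.coeFn_smul, Pi.smul_apply]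
  rw [Finset.sum_eq_single k]
  · simp
  · intro i _ hi
    rw [lp.single_apply_ne _ _ _ hi.symm, smul_zero]
  · intro hk
    rw [coeff_eq_zero_of_natDegree_lt (by simpa using hk), zero_smul]

/-- Parseval's identity for the coefficients of `q`. -/
theorem norm_aeval_shift_one_sq (q : ℂ[X]) :
    ‖aeval shift q one‖ ^ 2 = ∫ t, ‖q.eval (circleExp t)‖ ^ 2 ∂circleHaar := by
  have h := integral_norm_sum_circleExp_pow_smul_sq (Finset.range (q.natDegree + 1)) q.coeff
  have h2 : ‖aeval shift q one‖ ^ 2 = ∑' k, ‖q.coeff k‖ ^ 2 := by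
    have := lp.norm_rpow_eq_tsum (p := 2) (by simp) (aeval shift q one)
    simpa [aeval_shift_one_apply] using this
  rw [h2, tsum_eq_sum (s := Finset.range (q.natDegree + 1)) fun k hk => by
    rw [coeff_eq_zero_of_natDegree_lt (by simpa using hk)]; simp, ← h]
  refine integral_congr_ae (ae_of_all _ fun t => ?_)
  simp only [eval_eq_sum_range, smul_eq_mul, mul_comm]

theorem dense_range_aeval_shift_one : DenseRange fun q : ℂ[X] => aeval shift q one := by
  intro f
  refine mem_closure_of_tendsto (lp.hasSum_single (p := 2) (by simp) f)
    (Eventually.of_forall fun s => ⟨∑ k ∈ s, monomial k (f k), ?_⟩)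
  simp only [map_sum, sum_apply, aeval_monomial, ← Algebra.smul_def, smul_apply, shift_pow_one]
  refine Finset.sum_congr rfl fun k _ => ?_
  rw [← lp.single_smul, smul_eq_mul, mul_one]

/-- A lower bound of a polynomial on the circle is a lower bound of the multiplication operator. -/
theorem mul_norm_le_norm_aeval_shift {q : ℂ[X]} {c : ℝ} (hc : 0 ≤ c)
    (hq : ∀ z : ℂ, ‖z‖ = 1 → c ≤ ‖q.eval z‖) (f : H2Disk) : c * ‖f‖ ≤ ‖aeval shift q f‖ := by
  refine dense_range_aeval_shift_one.induction_on (p := fun f => c * ‖f‖ ≤ ‖aeval shift q f‖) f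
    (isClosed_le (by fun_prop) (by fun_prop)) fun g => ?_
  refine le_of_sq_le_sq ?_ (norm_nonneg _)
  rw [← mul_apply_eq_comp, ← map_mul, mul_pow, norm_aeval_shift_one_sq, norm_aeval_shift_one_sq,
    ← integral_const_mul]
  have hcont := continuous_circleExp
  have hint : ∀ r : ℂ[X], Continuous fun t => ‖r.eval (circleExp t)‖ ^ 2 := fun r => by
    have := r.continuous
    fun_prop
  have hi : ∀ r : ℂ[X], Integrable (fun t => ‖r.eval (circleExp t)‖ ^ 2) circleHaar := fun r =>
    (hint r).integrable_of_hasCompactSupport (HasCompactSupport.of_compactSpace _)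
  refine integral_mono ((hi g).const_mul _) (hi (q * g)) fun t => ?_
  simp only [eval_mul, norm_mul, mul_pow]
  gcongr
  exact hq _ (norm_circleExp t)

theorem aeval_fstSlice (p : MvPolynomial (Fin 2) ℂ) (τ : ℂ) (f : H2Disk) :
    aeval shift (fstSlice p τ) f =
      ∑ s ∈ p.support, (p.coeff s * τ ^ s 1) • (shift ^ s 0) f := by
  rw [fstSlice_eq_sum, map_sum, sum_apply]
  refine Finset.sum_congr rfl fun s _ => ?_
  rw [C_mul_X_pow_eq_monomial, aeval_monomial, ← Algebra.smul_def, smul_apply]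

theorem aeval_fstSlice_reflectedPoly (m n : ℕ) (p : MvPolynomial (Fin 2) ℂ) (τ : ℂ)
    (f : H2Disk) :
    aeval shift (fstSlice (reflectedPoly m n p) τ) f =
      ∑ s ∈ p.support, (conj (p.coeff s) * τ ^ (n - s 1)) • (shift ^ (m - s 0)) f := by
  rw [reflectedPoly, fstSlice, map_sum, map_sum, sum_apply]
  refine Finset.sum_congr rfl fun s _ => ?_
  have hs : MvPolynomial.aeval ![X, C τ] (MvPolynomial.monomial
      (Finsupp.single 0 (m - s 0) + Finsupp.single 1 (n - s 1)) (conj (p.coeff s))) =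
        monomial (m - s 0) (conj (p.coeff s) * τ ^ (n - s 1)) := by
    rw [MvPolynomial.aeval_monomial, Finsupp.prod_fintype _ _ (by simp), ← C_mul_X_pow_eq_monomial]
    simp [Fin.prod_univ_two]
    ring
  rw [hs, aeval_monomial, ← Algebra.smul_def, smul_apply]

/-- The one-variable counterpart of `H2Bidisk.inner_polyMul_reflectedPoly`. The factor `conj (τⁿ)`
arises because `conj (τⁿ) τᵏ = conj (τⁿ⁻ᵏ)` on the circle. -/
theorem inner_aeval_fstSlice_reflectedPoly {m n : ℕ} {p : MvPolynomial (Fin 2) ℂ}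
    (hm : p.degreeOf 0 ≤ m) (hn : p.degreeOf 1 ≤ n) {τ : ℂ} (hτ : ‖τ‖ = 1) (a : ℕ)
    (f : H2Disk) :
    inner ℂ (aeval shift (fstSlice (reflectedPoly m n p) τ) ((shift ^ a) one)) f =
      conj (τ ^ n) * aeval shift (fstSlice p τ) f (m + a) := by
  rw [aeval_fstSlice_reflectedPoly, aeval_fstSlice, sum_inner, lp.coeFn_sum, Finset.sum_apply,
    Finset.mul_sum]
  refine Finset.sum_congr rfl fun s hs => ?_
  have hs0 : s 0 ≤ m := (MvPolynomial.degreeOf_le_iff.1 hm) s hs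
  have hs1 : s 1 ≤ n := (MvPolynomial.degreeOf_le_iff.1 hn) s hs
  have hττ : conj τ * τ = 1 := by
    rw [Complex.conj_mul', hτ]; simp
  have hpow : conj (τ ^ n) * τ ^ s 1 = conj (τ ^ (n - s 1)) := by
    rw [← Nat.sub_add_cancel hs1, pow_add, map_mul, mul_assoc, map_pow conj τ (s 1), ← mul_pow, hττ]
    simp
  rw [← mul_apply_eq_comp, ← pow_add, inner_smul_left, inner_shift_pow_one, lp.coeFn_smul,
    Pi.smul_apply, shift_pow_apply, if_pos (by omega), smul_eq_mul,
    show m + a - s 0 = m - s 0 + a by omega, map_mul, Complex.conj_conj, ← hpow]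
  ring

/-- By continuity it is enough to test `f = zᵃ`. No invertibility of `p(·, τ)` is needed here. -/
theorem inner_aeval_fstSlice_reflectedPoly_eq_zero {m n : ℕ} {p : MvPolynomial (Fin 2) ℂ}
    (hm : p.degreeOf 0 ≤ m) (hn : p.degreeOf 1 ≤ n) {τ : ℂ} (hτ : ‖τ‖ = 1) {h : H2Disk}
    (hh : ∀ a, aeval shift (fstSlice p τ) h (m + a) = 0) (f : H2Disk) :
    inner ℂ (aeval shift (fstSlice (reflectedPoly m n p) τ) f) h = 0 := by
  have h0 : (innerSL ℂ h).comp (aeval shift (fstSlice (reflectedPoly m n p) τ)) = 0 := by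
    refine clm_ext fun a => ?_
    rw [ContinuousLinearMap.comp_apply, innerSL_apply_apply, ← inner_conj_symm,
      inner_aeval_fstSlice_reflectedPoly hm hn hτ, hh]
    simp
  rw [← inner_conj_symm, ← innerSL_apply_apply, ← ContinuousLinearMap.comp_apply, h0]
  simp

/-- The model space of a slice consists of the `q / p(·, τ)` with `q` a polynomial of degree less
than `m`. -/
theorem mem_modelSpace_iff {m n : ℕ} {p : MvPolynomial (Fin 2) ℂ} (hp : IsRationalInner p m n)
    {τ : ℂ} (hτ : ‖τ‖ = 1) (hE : τ ∉ exceptionalSet p) {h : H2Disk} :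
    h ∈ modelSpace (fun z => rationalInner p m n z τ) ↔
      ∀ a, aeval shift (fstSlice p τ) h (m + a) = 0 := by
  have hm := hp.degreeOf_fst_le
  have hn := hp.degreeOf_snd_le
  have hne : ∀ z : ℂ, ‖z‖ ≤ 1 → MvPolynomial.eval ![z, τ] p ≠ 0 := fun z hz =>
    hp.eval_ne_zero_of_notMem_exceptionalSet hz hτ hE
  have hτ0 : τ ≠ 0 := norm_ne_zero_iff.1 (by rw [hτ]; exact one_ne_zero)
  rw [modelSpace, Submodule.mem_orthogonal]
  constructor
  · intro hh a
    -- The test vector is `p̃(·, τ) zᵃ = Θ_τ · p(·, τ) zᵃ`, an element of `Θ_τ H²`.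
    have := hh (aeval shift (fstSlice (reflectedPoly m n p) τ) ((shift ^ a) one))
      ⟨aeval shift (fstSlice p τ) ((shift ^ a) one), fun z hz => by
        simp only [eval_aeval_shift _ _ hz, eval_fstSlice, rationalInner]
        field_simp [hne z hz.le]⟩
    rw [inner_aeval_fstSlice_reflectedPoly hm hn hτ] at this
    simpa [hτ0] using this
  · rintro hh g ⟨f, hf⟩
    have hu : IsUnit (aeval shift (fstSlice p τ)) :=
      isUnit_aeval_shift fun z hz => by simpa using hne z hz
    obtain ⟨u, hu⟩ := hu
    -- Since `p(·, τ)` is invertible, `Θ_τ f` is `p̃(·, τ)` times the function `p(·, τ)⁻¹ f` of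
    -- `H²`.
    have hg : g = aeval shift (fstSlice (reflectedPoly m n p) τ) ((↑u⁻¹ : H2Disk →L[ℂ] H2Disk) f) := by
      refine ext_eval fun z hz => ?_
      have hf' : f = aeval shift (fstSlice p τ) ((↑u⁻¹ : H2Disk →L[ℂ] H2Disk) f) := by
        rw [← hu, ← mul_apply_eq_comp, u.mul_inv, one_apply_eq_self]
      rw [hf z hz, eval_aeval_shift _ _ hz]
      conv_lhs => rw [hf']
      simp only [eval_aeval_shift _ _ hz, eval_fstSlice, rationalInner]
      field_simp [hne z hz.le]
    rw [hg]
    exact inner_aeval_fstSlice_reflectedPoly_eq_zero hm hn hτ hh _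

end H2Disk

/-! ### The slices of a function on the bidisk -/

namespace H2Bidisk

open H2Disk

/-- The square-integrable functions on the circle with values in `H²(𝔻)`. -/
abbrev SliceSpace : Type := Lp H2Disk 2 circleHaar

theorem memLp_sliceMonomial (j k : ℕ) :
    MemLp (fun t => circleExp t ^ k • (H2Disk.shift ^ j) H2Disk.one) 2 circleHaar := by
  have hc : Continuous fun t => circleExp t ^ k • (H2Disk.shift ^ j) H2Disk.one := by
    have := continuous_circleExp
    fun_prop
  refine MemLp.of_bound hc.aestronglyMeasurable ‖(H2Disk.shift ^ j) H2Disk.one‖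
    (ae_of_all _ fun t => ?_)
  rw [norm_smul, norm_pow, norm_circleExp, one_pow, one_mul]

/-- The function `t ↦ z₁ʲ e(t)ᵏ`. -/
def sliceMonomial (i : ℕ × ℕ) : SliceSpace := (memLp_sliceMonomial i.1 i.2).toLp

theorem coeFn_sliceMonomial (i : ℕ × ℕ) :
    sliceMonomial i =ᵐ[circleHaar]
      fun t => circleExp t ^ i.2 • (H2Disk.shift ^ i.1) H2Disk.one :=
  MemLp.coeFn_toLp _

theorem orthonormal_sliceMonomial : Orthonormal ℂ sliceMonomial := by
  rw [orthonormal_iff_ite]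
  rintro ⟨j, k⟩ ⟨j', k'⟩
  rw [L2.inner_def]
  have h : ∀ᵐ t ∂circleHaar, inner ℂ (sliceMonomial (j, k) t) (sliceMonomial (j', k') t) =
      conj (circleExp t ^ k) * circleExp t ^ k' * if j = j' then 1 else 0 := by
    filter_upwards [coeFn_sliceMonomial (j, k), coeFn_sliceMonomial (j', k')] with t h₁ h₂
    rw [h₁, h₂, inner_smul_left, inner_smul_right, H2Disk.inner_shift_pow_one,
      H2Disk.shift_pow_one, ← mul_assoc]
    congr 1
    split_ifs with hj
    · subst hj; simp
    · exact lp.single_apply_ne _ _ _ hj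
  rw [integral_congr_ae h, integral_mul_const, integral_conj_circleExp_pow_mul]
  simp only [Prod.mk.injEq]
  split_ifs <;> simp_all

/-- The isometry that sends a function `f` on the bidisk to its slices `t ↦ f(·, e(t))`. -/
def slice : H2Bidisk →ₗᵢ[ℂ] SliceSpace :=
  orthonormal_sliceMonomial.orthogonalFamily.linearIsometry

theorem slice_single (i : ℕ × ℕ) (c : ℂ) :
    slice (lp.single 2 i c) = c • sliceMonomial i := by
  rw [slice, OrthogonalFamily.linearIsometry_apply_single]
  simp

theorem hasSum_slice (f : H2Bidisk) : HasSum (fun i => f i • sliceMonomial i) (slice f) := by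
  have h := orthonormal_sliceMonomial.orthogonalFamily.hasSum_linearIsometry f
  simp only [LinearIsometry.toSpanSingleton_apply] at h
  exact h

theorem inner_eq_integral (f g : H2Bidisk) :
    inner ℂ f g = ∫ t, inner ℂ (slice f t) (slice g t) ∂circleHaar := by
  rw [← slice.inner_map_map, L2.inner_def]

theorem integrable_inner_slice (f g : H2Bidisk) :
    Integrable (fun t => inner ℂ (slice f t) (slice g t)) circleHaar :=
  L2.integrable_inner _ _

/-- Taking the `j`-th coefficient of every slice is continuous into `L²(𝕋)`, so it may be applied
termwise to the expansion of `slice g`. Terms of first index `j` have coefficient zero, and the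
others have no `j`-th coefficient. -/
theorem ae_slice_apply_eq_zero {g : H2Bidisk} {j : ℕ} (hg : ∀ k, g (j, k) = 0) :
    ∀ᵐ t ∂circleHaar, slice g t j = 0 := by
  let A : SliceSpace →L[ℂ] Lp ℂ 2 circleHaar :=
    (lp.evalCLM ℂ (fun _ : ℕ => ℂ) 2 j).compLpL 2 circleHaar
  have h0 : ∀ i : ℕ × ℕ, A (g i • sliceMonomial i) = 0 := by
    rintro ⟨j', k⟩
    rcases eq_or_ne j j' with rfl | hj
    · rw [hg, zero_smul, map_zero]
    · have : A (sliceMonomial (j', k)) = 0 := by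
        refine (Lp.eq_zero_iff_ae_eq_zero).2 ?_
        filter_upwards [(lp.evalCLM ℂ (fun _ : ℕ => ℂ) 2 j).coeFn_compLp (sliceMonomial (j', k)),
          coeFn_sliceMonomial (j', k)] with t h₁ h₂
        refine h₁.trans ?_
        rw [h₂, map_smul, H2Disk.shift_pow_one]
        simp [lp.evalCLM, Pi.single_eq_of_ne hj]
      rw [map_smul, this, smul_zero]
  have hA : A (slice g) = 0 := by
    have := A.hasSum (hasSum_slice g)
    simp only [h0] at this
    exact this.unique hasSum_zero
  have hA' := (Lp.eq_zero_iff_ae_eq_zero).1 hA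
  filter_upwards [hA', (lp.evalCLM ℂ (fun _ : ℕ => ℂ) 2 j).coeFn_compLp (slice g)] with t h₁ h₂
  exact h₂.symm.trans h₁

/-- The operator `T` acts on almost every slice `t` by `A t`. -/
def ActsOnSlices (T : H2Bidisk →L[ℂ] H2Bidisk) (A : UnitAddCircle → H2Disk →L[ℂ] H2Disk) : Prop :=
  ∀ f, ∀ᵐ t ∂circleHaar, slice (T f) t = A t (slice f t)

namespace ActsOnSlices

variable {T T' : H2Bidisk →L[ℂ] H2Bidisk} {A A' : UnitAddCircle → H2Disk →L[ℂ] H2Disk}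

theorem one : ActsOnSlices 1 1 := fun _ => ae_of_all _ fun _ => rfl

theorem mul (h : ActsOnSlices T A) (h' : ActsOnSlices T' A') :
    ActsOnSlices (T * T') (A * A') := fun f => by
  filter_upwards [h (T' f), h' f] with t h₁ h₂
  rw [mul_apply_eq_comp, h₁, h₂]
  rfl

theorem pow (h : ActsOnSlices T A) (k : ℕ) : ActsOnSlices (T ^ k) (A ^ k) := by
  induction k with
  | zero => simpa using one
  | succ k ih => simpa only [pow_succ] using ih.mul h

theorem smul (h : ActsOnSlices T A) (c : ℂ) : ActsOnSlices (c • T) (c • A) := fun f => by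
  have h1 := Lp.coeFn_smul c (slice (T f))
  rw [← map_smul] at h1
  filter_upwards [h f, h1] with t h₁ h₂
  rw [smul_apply, h₂, Pi.smul_apply, h₁]
  rfl

theorem add (h : ActsOnSlices T A) (h' : ActsOnSlices T' A') :
    ActsOnSlices (T + T') (A + A') := fun f => by
  have h1 := Lp.coeFn_add (slice (T f)) (slice (T' f))
  rw [← map_add] at h1
  filter_upwards [h f, h' f, h1] with t h₁ h₂ h₃
  rw [add_apply, h₃, Pi.add_apply, h₁, h₂]
  rfl

theorem zero : ActsOnSlices 0 0 := by simpa using one.smul 0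

theorem sum {ι : Type*} {s : Finset ι} {T : ι → H2Bidisk →L[ℂ] H2Bidisk}
    {A : ι → UnitAddCircle → H2Disk →L[ℂ] H2Disk} (h : ∀ i, ActsOnSlices (T i) (A i)) :
    ActsOnSlices (∑ i ∈ s, T i) (∑ i ∈ s, A i) := by
  classical
  induction s using Finset.induction_on with
  | empty => simpa using zero
  | insert i s hi ih =>
    rw [Finset.sum_insert hi, Finset.sum_insert hi]
    exact (h i).add ih

theorem aeval (h : ActsOnSlices T A) (q : ℂ[X]) :
    ActsOnSlices (Polynomial.aeval T q) fun t => Polynomial.aeval (A t) q := by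
  have h1 := sum (s := Finset.range (q.natDegree + 1)) fun k => (h.pow k).smul (q.coeff k)
  rw [← Polynomial.aeval_eq_sum_range] at h1
  convert h1 using 1
  ext1 t
  rw [Polynomial.aeval_eq_sum_range, Finset.sum_apply]
  rfl

end ActsOnSlices

/-- Both sides are continuous in `f` as elements of `SliceSpace` and agree on monomials. -/
theorem actsOnSlices_shift₁ : ActsOnSlices shift₁ fun _ => H2Disk.shift := by
  have h : slice.toContinuousLinearMap.comp shift₁ =
      (H2Disk.shift.compLpL 2 circleHaar).comp slice.toContinuousLinearMap := by
    refine lp_two_clm_ext fun i => ?_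
    change slice (shift₁ (lp.single 2 i 1)) = H2Disk.shift.compLp (slice (lp.single 2 i 1))
    rw [shift₁_single, slice_single, slice_single, one_smul, one_smul]
    refine Lp.ext ?_
    filter_upwards [coeFn_sliceMonomial i, coeFn_sliceMonomial (i.1 + 1, i.2),
      H2Disk.shift.coeFn_compLp (sliceMonomial i)] with t h₁ h₂ h₃
    rw [h₂, h₃, h₁, map_smul, pow_succ' H2Disk.shift, mul_apply_eq_comp]
  intro f
  have hf : slice (shift₁ f) = H2Disk.shift.compLp (slice f) := DFunLike.congr_fun h f
  rw [hf]
  exact H2Disk.shift.coeFn_compLp (slice f)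

theorem memLp_circleExp_smul (g : SliceSpace) :
    MemLp (fun t => circleExp t • g t) 2 circleHaar :=
  (Lp.memLp g).of_le
    (continuous_circleExp.aestronglyMeasurable.smul (Lp.aestronglyMeasurable g))
    (ae_of_all _ fun t => by rw [norm_smul, norm_circleExp, one_mul])

/-- Multiplication by the coordinate function of the circle. -/
def circleMul : SliceSpace →L[ℂ] SliceSpace :=
  LinearMap.mkContinuous
    { toFun := fun g => (memLp_circleExp_smul g).toLp
      map_add' := fun g g' => by
        refine Lp.ext ?_
        filter_upwards [(memLp_circleExp_smul (g + g')).coeFn_toLp,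
          (memLp_circleExp_smul g).coeFn_toLp, (memLp_circleExp_smul g').coeFn_toLp,
          Lp.coeFn_add g g', Lp.coeFn_add (memLp_circleExp_smul g).toLp
            (memLp_circleExp_smul g').toLp] with t h₁ h₂ h₃ h₄ h₅
        rw [h₁, h₅, h₄, Pi.add_apply, Pi.add_apply, h₂, h₃, smul_add]
      map_smul' := fun c g => by
        refine Lp.ext ?_
        filter_upwards [(memLp_circleExp_smul (c • g)).coeFn_toLp,
          (memLp_circleExp_smul g).coeFn_toLp, Lp.coeFn_smul c g,
          Lp.coeFn_smul c (memLp_circleExp_smul g).toLp] with t h₁ h₂ h₃ h₄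
        rw [h₁, RingHom.id_apply, h₄, h₃, Pi.smul_apply, Pi.smul_apply, h₂, smul_comm] }
    1 fun g => by
      rw [one_mul]
      refine Lp.norm_le_norm_of_ae_le ?_
      filter_upwards [(memLp_circleExp_smul g).coeFn_toLp] with t h₁
      refine (congrArg norm h₁).trans_le ?_
      rw [norm_smul, norm_circleExp, one_mul]

theorem coeFn_circleMul (g : SliceSpace) :
    circleMul g =ᵐ[circleHaar] fun t => circleExp t • g t :=
  (memLp_circleExp_smul g).coeFn_toLp

theorem actsOnSlices_shift₂ : ActsOnSlices shift₂ fun t => circleExp t • 1 := by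
  have h : slice.toContinuousLinearMap.comp shift₂ =
      circleMul.comp slice.toContinuousLinearMap := by
    refine lp_two_clm_ext fun i => ?_
    change slice (shift₂ (lp.single 2 i 1)) = circleMul (slice (lp.single 2 i 1))
    rw [shift₂_single, slice_single, slice_single, one_smul, one_smul]
    refine Lp.ext ?_
    filter_upwards [coeFn_sliceMonomial i, coeFn_sliceMonomial (i.1, i.2 + 1),
      coeFn_circleMul (sliceMonomial i)] with t h₁ h₂ h₃
    rw [h₂, h₃, h₁, pow_succ', mul_smul]
  intro f
  have hf : slice (shift₂ f) = circleMul (slice f) := DFunLike.congr_fun h f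
  rw [hf]
  exact coeFn_circleMul (slice f)

theorem actsOnSlices_aeval_shift₂ (q : ℂ[X]) :
    ActsOnSlices (Polynomial.aeval shift₂ q) fun t => q.eval (circleExp t) • 1 := by
  convert actsOnSlices_shift₂.aeval q using 2 with t
  rw [← Algebra.algebraMap_eq_smul_one, ← Algebra.algebraMap_eq_smul_one,
    Polynomial.aeval_algebraMap_apply, Polynomial.coe_aeval_eq_eval]

theorem actsOnSlices_polyMul (p : MvPolynomial (Fin 2) ℂ) :
    ActsOnSlices (polyMul p) fun t =>
      Polynomial.aeval H2Disk.shift (fstSlice p (circleExp t)) := by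
  have h1 := ActsOnSlices.sum (s := p.support) fun s =>
    ((actsOnSlices_shift₁.pow (s 0)).mul (actsOnSlices_shift₂.pow (s 1))).smul (p.coeff s)
  refine (congrArg (ActsOnSlices (polyMul p)) ?_).mpr h1
  ext1 t
  ext1 f
  rw [aeval_fstSlice, Finset.sum_apply, sum_apply]
  refine Finset.sum_congr rfl fun s _ => ?_
  simp [smul_pow, mul_smul]

end H2Bidisk

/-! ### Numerical ranges of compressions -/

section NumericalRange

variable {H : Type*} [NormedAddCommGroup H] [InnerProductSpace ℂ H]

/-- The projection drops out of `⟨h, P_S T h⟩` for `h ∈ S`, so numerical ranges of compressions can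
be handled in the ambient space. -/
theorem mem_numericalRange_compression {T : H →L[ℂ] H} {S : Submodule ℂ H}
    [S.HasOrthogonalProjection] {c : ℂ} :
    c ∈ numericalRange (compression T S) ↔ ∃ h ∈ S, ‖h‖ = 1 ∧ inner ℂ h (T h) = c := by
  have key : ∀ h : S, inner ℂ h (compression T S h) = inner ℂ (h : H) (T h) := fun h =>
    S.inner_orthogonalProjectionOnto_eq_of_mem_left h (T h)
  constructor
  · rintro ⟨h, h1, h2⟩
    exact ⟨h, h.2, h1, by rw [← key, h2]⟩
  · rintro ⟨h, hS, h1, h2⟩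
    exact ⟨⟨h, hS⟩, h1, by rw [key, h2]⟩

theorem smul_inner_mem_numericalRange_compression {T : H →L[ℂ] H} {S : Submodule ℂ H}
    [S.HasOrthogonalProjection] {h : H} (hS : h ∈ S) (h0 : h ≠ 0) :
    (‖h‖ ^ 2)⁻¹ • inner ℂ h (T h) ∈ numericalRange (compression T S) := by
  refine mem_numericalRange_compression.2 ⟨((‖h‖⁻¹ : ℝ) : ℂ) • h, S.smul_mem _ hS, ?_, ?_⟩
  · rw [norm_smul, Complex.norm_real, norm_inv, norm_norm,
      inv_mul_cancel₀ (norm_ne_zero_iff.2 h0)]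
  · rw [map_smul, inner_smul_left, inner_smul_right, Complex.conj_ofReal, Complex.real_smul]
    push_cast
    ring

theorem mem_closure_numericalRange_of_tendsto {ι : Type*} {l : Filter ι} [l.NeBot]
    {T : H →L[ℂ] H} {S : Submodule ℂ H} [S.HasOrthogonalProjection] {u : ι → H} {c : ℂ}
    (hS : ∀ i, u i ∈ S) {r : ℝ} (hr : r ≠ 0) (hu : Tendsto (fun i => ‖u i‖ ^ 2) l (𝓝 r))
    (hc : Tendsto (fun i => inner ℂ (u i) (T (u i))) l (𝓝 c)) :
    r⁻¹ • c ∈ closure (numericalRange (compression T S)) := by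
  refine mem_closure_of_tendsto ((hu.inv₀ hr).smul hc) ?_
  filter_upwards [hu.eventually_ne hr] with i hi
  exact smul_inner_mem_numericalRange_compression (hS i) (by rintro h; simp [h] at hi)

end NumericalRange

/-! ### Weak decay of the powers of `shift₂` and convexity of the closed numerical range -/

namespace H2Bidisk

theorem inner_shift₂_pow (N : ℕ) (f g : H2Bidisk) :
    inner ℂ ((shift₂ ^ N) f) ((shift₂ ^ N) g) = inner ℂ f g := by
  induction N with
  | zero => simp
  | succ N ih =>
    rw [pow_succ', mul_apply_eq_comp, mul_apply_eq_comp, ← ih]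
    exact LinearIsometry.inner_map_map _ _ _

theorem norm_shift₂_pow (N : ℕ) (f : H2Bidisk) : ‖(shift₂ ^ N) f‖ = ‖f‖ := by
  induction N with
  | zero => simp
  | succ N ih => rw [pow_succ', mul_apply_eq_comp, norm_shift₂, ih]

theorem shift₁_shift₂_pow (N : ℕ) (f : H2Bidisk) :
    shift₁ ((shift₂ ^ N) f) = (shift₂ ^ N) (shift₁ f) :=
  ext_eval fun z₁ z₂ _ _ => by simp only [eval_shift₁, eval_shift₂_pow]; ring

/-- The powers of the shift tend to `0` weakly. -/
theorem tendsto_inner_shift₂_pow (x f : H2Bidisk) :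
    Tendsto (fun N : ℕ => inner ℂ x ((shift₂ ^ N) f)) atTop (𝓝 0) := by
  rw [Metric.tendsto_atTop]
  intro ε hε
  have hδ : 0 < ε / (‖f‖ + 1) := by positivity
  obtain ⟨s, hs⟩ := ((lp.hasSum_single (p := 2) (by simp) x).eventually
    (Metric.ball_mem_nhds x hδ)).exists
  -- Beyond the largest second index in `s`, `z₂ᴺ f` has no coefficient on `s`, so only the tail of
  -- `x` contributes. The `+ 1` in the denominator of the tolerance covers `f = 0`.
  refine ⟨s.sup (fun i => i.2) + 1, fun N hN => ?_⟩
  have h0 : inner ℂ (∑ i ∈ s, lp.single (E := fun _ : ℕ × ℕ => ℂ) 2 i (x i))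
      ((shift₂ ^ N) f) = 0 := by
    rw [sum_inner]
    refine Finset.sum_eq_zero fun i hi => ?_
    have hi2 : i.2 ≤ s.sup fun i => i.2 := Finset.le_sup (f := fun i : ℕ × ℕ => i.2) hi
    rw [lp.inner_single_left, shift₂_pow_apply, if_neg (by omega), inner_zero_right]
  rw [dist_zero_right, ← sub_zero (inner ℂ x _), ← h0, ← inner_sub_left]
  refine (norm_inner_le_norm _ _).trans_lt ?_
  rw [norm_shift₂_pow]
  have h1 : ‖x - ∑ i ∈ s, lp.single (E := fun _ : ℕ × ℕ => ℂ) 2 i (x i)‖ < ε / (‖f‖ + 1) := by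
    rw [← dist_eq_norm, dist_comm]
    exact hs
  calc _ ≤ ε / (‖f‖ + 1) * ‖f‖ := by gcongr
    _ < ε / (‖f‖ + 1) * (‖f‖ + 1) := by gcongr; linarith
    _ = ε := by field_simp

/-- The closure of the numerical range of the compression of `z₁` to a subspace that is invariant
under `z₂` is convex. -/
theorem convex_closure_numericalRange_compression {S : Submodule ℂ H2Bidisk}
    [S.HasOrthogonalProjection] (hS : ∀ f ∈ S, shift₂ f ∈ S) :
    Convex ℝ (closure (numericalRange (compression shift₁ S))) := by
  have hpow : ∀ N : ℕ, ∀ f ∈ S, (shift₂ ^ N) f ∈ S := by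
    intro N f hf
    induction N with
    | zero => simpa
    | succ N ih => rw [pow_succ', mul_apply_eq_comp]; exact hS _ ih
  intro x hx y hy a b ha hb hab
  refine map_mem_closure₂ (f := fun x y : ℂ => a • x + b • y) (u := closure _) (by fun_prop)
    hx hy ?_ |> fun h => by simpa only [closure_closure] using h
  clear hx hy x y
  intro x hx y hy
  obtain ⟨f, hf, hf1, rfl⟩ := mem_numericalRange_compression.1 hx
  obtain ⟨g, hg, hg1, rfl⟩ := mem_numericalRange_compression.1 hy
  -- The convex combination is attained in the limit by `√a f + √b z₂ᴺ g`, whose cross terms vanish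
  -- as `N → ∞`.
  set α : ℂ := ((√a : ℝ) : ℂ)
  set β : ℂ := ((√b : ℝ) : ℂ)
  have hα : α * α = (a : ℂ) := by rw [← Complex.ofReal_mul, Real.mul_self_sqrt ha]
  have hβ : β * β = (b : ℂ) := by rw [← Complex.ofReal_mul, Real.mul_self_sqrt hb]
  have hα' : conj α = α := Complex.conj_ofReal _
  have hβ' : conj β = β := Complex.conj_ofReal _
  have hw : ∀ u v : H2Bidisk,
      Tendsto (fun N : ℕ => inner ℂ ((shift₂ ^ N) u) v) atTop (𝓝 0) := fun u v => by
    have := (Complex.continuous_conj.tendsto 0).comp (tendsto_inner_shift₂_pow v u)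
    simpa [Function.comp_def] using this
  -- This limit is used twice: with `(f, g)` for the norm and with `(z₁ f, z₁ g)` for the quadratic
  -- form.
  have hinner : ∀ v w : H2Bidisk, Tendsto (fun N : ℕ => α * α * inner ℂ f v +
      β * β * inner ℂ g w + α * β * (inner ℂ f ((shift₂ ^ N) w) + inner ℂ ((shift₂ ^ N) g) v))
      atTop (𝓝 (a • inner ℂ f v + b • inner ℂ g w)) := fun v w => by
    have h := (tendsto_const_nhds (x := α * α * inner ℂ f v + β * β * inner ℂ g w)).add
      (((tendsto_inner_shift₂_pow f w).add (hw g v)).const_mul (α * β))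
    simpa [hα, hβ] using h
  have key := mem_closure_numericalRange_of_tendsto (T := shift₁) (S := S) (l := atTop)
    (u := fun N : ℕ => α • f + β • (shift₂ ^ N) g)
    (c := a • inner ℂ f (shift₁ f) + b • inner ℂ g (shift₁ g))
    (fun N => S.add_mem (S.smul_mem _ hf) (S.smul_mem _ (hpow N g hg))) one_ne_zero ?_ ?_
  · simpa using key
  · have h := (Complex.continuous_re.tendsto _).comp (hinner f g)
    refine (h.congr fun N => ?_).trans (le_of_eq ?_)
    · rw [Function.comp_apply, ← inner_self_eq_norm_sq (𝕜 := ℂ)]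
      simp only [inner_add_left, inner_add_right, inner_smul_left, inner_smul_right,
        inner_shift₂_pow, hα', hβ', RCLike.re_eq_complex_re]
      congr 1
      ring
    · simp [inner_self_eq_norm_sq_to_K, hf1, hg1, ← Complex.ofReal_add, hab]
  · refine (hinner (shift₁ f) (shift₁ g)).congr fun N => ?_
    simp only [map_add, map_smul, inner_add_left, inner_add_right, inner_smul_left,
      inner_smul_right, shift₁_shift₂_pow, inner_shift₂_pow, hα', hβ']
    ring

/-! ### The largest subspace of the model space that is invariant under `z₂` -/

/-- The functions `f` for which the `z₁`-degree of `p f` is less than `m`. -/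
def lowFst (p : MvPolynomial (Fin 2) ℂ) (m : ℕ) : Submodule ℂ H2Bidisk where
  carrier := {f | ∀ j k, polyMul p f (m + j, k) = 0}
  zero_mem' := fun j k => by simp
  add_mem' := fun hf hg j k => by simp [hf j k, hg j k]
  smul_mem' := fun c f hf j k => by simp [hf j k]

theorem shift₂_pow_mem_lowFst {p : MvPolynomial (Fin 2) ℂ} {m : ℕ} {f : H2Bidisk}
    (hf : f ∈ lowFst p m) (N : ℕ) : (shift₂ ^ N) f ∈ lowFst p m := fun j k => by
  rw [polyMul_shift₂_pow, shift₂_pow_apply]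
  split_ifs
  · exact hf _ _
  · rfl

variable {p : MvPolynomial (Fin 2) ℂ} {m n : ℕ}

theorem polyMul_injective (hp : IsRationalInner p m n) : Function.Injective (polyMul p) := by
  refine fun f g h => ext_eval fun z₁ z₂ h₁ h₂ => ?_
  refine mul_left_cancel₀ (hp.eval_ne_zero z₁ z₂ h₁ h₂) ?_
  rw [← eval_polyMul p f h₁ h₂, ← eval_polyMul p g h₁ h₂, h]

/-- The coefficient is the inner product with `p̃ z₁ᵃ z₂ᵇ = Θ · (p z₁ᵃ z₂ᵇ)`, which lies in `Θ H²`.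
-/
theorem polyMul_apply_eq_zero_of_mem_modelSpace (hp : IsRationalInner p m n) {f : H2Bidisk}
    (hf : f ∈ modelSpace (rationalInner p m n)) (a b : ℕ) : polyMul p f (m + a, n + b) = 0 := by
  rw [← inner_polyMul_reflectedPoly hp.degreeOf_fst_le hp.degreeOf_snd_le]
  refine (Submodule.mem_orthogonal _ _).1 hf _
    ⟨polyMul p ((shift₁ ^ a) ((shift₂ ^ b) one)), fun z₁ z₂ h₁ h₂ => ?_⟩
  simp only [eval_polyMul _ _ h₁ h₂, rationalInner]
  field_simp [hp.eval_ne_zero z₁ z₂ h₁ h₂]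

instance : NullSingletonClass circleHaar := by
  have h : (volume : Measure UnitAddCircle) = circleHaar := by
    rw [AddCircle.volume_eq_smul_haarAddCircle]
    simp
  refine ⟨fun t => ?_⟩
  rw [← h, ← Metric.closedBall_zero, AddCircle.volume_closedBall]
  simp

theorem ae_circleExp_notMem_exceptionalSet (hp : IsRationalInner p m n) :
    ∀ᵐ t ∂circleHaar, circleExp t ∉ exceptionalSet p :=
  measure_eq_zero_iff_ae_notMem.1
    ((hp.finite_exceptionalSet.preimage circleExp_injective.injOn).measure_zero circleHaar)

theorem ae_slice_mem_modelSpace (hp : IsRationalInner p m n) {f : H2Bidisk}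
    (hf : f ∈ lowFst p m) :
    ∀ᵐ t ∂circleHaar,
      slice f t ∈ H2Disk.modelSpace fun z => rationalInner p m n z (circleExp t) := by
  filter_upwards [ae_circleExp_notMem_exceptionalSet hp, actsOnSlices_polyMul p f,
    ae_all_iff.2 fun j => ae_slice_apply_eq_zero (hf j)] with t hE h₁ h₂
  rw [H2Disk.mem_modelSpace_iff hp (norm_circleExp t) hE, ← h₁]
  exact h₂

/-- Orthogonality to `g = Θ g'` already holds on almost every slice. Since `p g = p̃ g'` and `p(·,
τ)` is invertible off the exceptional set, the slice of `g` is `p̃(·, τ)` times a function of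
`H²(𝔻)`. -/
theorem lowFst_le_modelSpace (hp : IsRationalInner p m n) :
    lowFst p m ≤ modelSpace (rationalInner p m n) := by
  intro f hf
  refine (Submodule.mem_orthogonal _ _).2 ?_
  rintro g ⟨g', hg⟩
  rw [inner_eq_integral]
  refine integral_eq_zero_of_ae ?_
  have hgg' : polyMul p g = polyMul (reflectedPoly m n p) g' := by
    refine ext_eval fun z₁ z₂ h₁ h₂ => ?_
    rw [eval_polyMul _ _ h₁ h₂, eval_polyMul _ _ h₁ h₂, hg z₁ z₂ h₁ h₂, rationalInner]
    field_simp [hp.eval_ne_zero z₁ z₂ h₁ h₂]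
  have h4 := actsOnSlices_polyMul p g
  rw [hgg'] at h4
  filter_upwards [ae_circleExp_notMem_exceptionalSet hp, actsOnSlices_polyMul p f,
    ae_all_iff.2 fun j => ae_slice_apply_eq_zero (hf j),
    actsOnSlices_polyMul (reflectedPoly m n p) g', h4] with t hE h₁ h₂ h₃ h₄
  obtain ⟨u, hu⟩ := H2Disk.isUnit_aeval_shift (q := fstSlice p (circleExp t)) fun z hz => by
    simpa using hp.eval_ne_zero_of_notMem_exceptionalSet hz (norm_circleExp t) hE
  have hcomm : Commute (↑u⁻¹ : H2Disk →L[ℂ] H2Disk)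
      (Polynomial.aeval H2Disk.shift (fstSlice (reflectedPoly m n p) (circleExp t))) := by
    refine Commute.units_inv_left ?_
    rw [hu]
    exact (Commute.all _ _).map (Polynomial.aeval H2Disk.shift)
  have hgt : slice g t = Polynomial.aeval H2Disk.shift
      (fstSlice (reflectedPoly m n p) (circleExp t))
        ((↑u⁻¹ : H2Disk →L[ℂ] H2Disk) (slice g' t)) := by
    rw [← mul_apply_eq_comp, ← hcomm.eq, mul_apply_eq_comp, ← h₃, h₄, ← hu, ← mul_apply_eq_comp,
      u.inv_mul, one_apply_eq_self]
  rw [hgt]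
  refine H2Disk.inner_aeval_fstSlice_reflectedPoly_eq_zero hp.degreeOf_fst_le hp.degreeOf_snd_le
    (norm_circleExp t) (fun a => ?_) _
  rw [← h₁]
  exact h₂ a

/-! ### Shift decompositions compared with `lowFst` -/

section Decomposition

variable {S₁ S₂ : ClosedSubmodule ℂ H2Bidisk}

/-- The function `z₁ᵐ f` is still in `S₁ ⊆ K_Θ`; the vanishing of its coefficient at `(m + j, n +
k)` is that of `p f` at `(j, n + k)`. -/
theorem polyMul_apply_eq_zero_of_mem_fst (hp : IsRationalInner p m n)
    (hS : IsShiftDecomposition (rationalInner p m n) S₁ S₂) {f : H2Bidisk} (hf : f ∈ S₁)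
    (j k : ℕ) : polyMul p f (j, n + k) = 0 := by
  have hmem : ∀ N : ℕ, (shift₁ ^ N) f ∈ S₁ := by
    intro N
    induction N with
    | zero => simpa
    | succ N ih => rw [pow_succ', mul_apply_eq_comp]; exact hS.shift₁_mem _ ih
  have h := polyMul_apply_eq_zero_of_mem_modelSpace hp
    (hS.sup_eq ▸ Submodule.mem_sup_left (hmem m)) j k
  rwa [polyMul_shift₁_pow, shift₁_pow_apply, if_pos (by omega), Nat.add_sub_cancel_left] at h

theorem snd_le_lowFst (hp : IsRationalInner p m n)
    (hS : IsShiftDecomposition (rationalInner p m n) S₁ S₂) : S₂.toSubmodule ≤ lowFst p m := by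
  intro f hf j k
  have hmem : ∀ N : ℕ, (shift₂ ^ N) f ∈ S₂ := by
    intro N
    induction N with
    | zero => simpa
    | succ N ih => rw [pow_succ', mul_apply_eq_comp]; exact hS.shift₂_mem _ ih
  have h := polyMul_apply_eq_zero_of_mem_modelSpace hp
    (hS.sup_eq ▸ Submodule.mem_sup_right (hmem n)) j k
  rwa [polyMul_shift₂_pow, shift₂_pow_apply, if_pos (by omega), Nat.add_sub_cancel_left] at h

/-- On the intersection `p f` is a polynomial of degree less than `m` in `z₁` and less than `n` in
`z₂`, and it determines `f`. -/
theorem finiteDimensional_fst_inf_lowFst (hp : IsRationalInner p m n)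
    (hS : IsShiftDecomposition (rationalInner p m n) S₁ S₂) :
    FiniteDimensional ℂ ↥(S₁.toSubmodule ⊓ lowFst p m) := by
  let A : ↥(S₁.toSubmodule ⊓ lowFst p m) →ₗ[ℂ] (Fin m × Fin n → ℂ) :=
    { toFun := fun f i => polyMul p f (i.1, i.2)
      map_add' := fun f g => by ext; simp
      map_smul' := fun c f => by ext; simp }
  refine FiniteDimensional.of_injective A fun f g h => Subtype.ext (polyMul_injective hp ?_)
  refine lp.ext (funext fun ⟨j, k⟩ => ?_)
  by_cases hj : j < m
  · by_cases hk : k < n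
    · exact congrFun h (⟨j, hj⟩, ⟨k, hk⟩)
    · obtain ⟨k, rfl⟩ := Nat.exists_eq_add_of_le (not_lt.1 hk)
      rw [polyMul_apply_eq_zero_of_mem_fst hp hS f.2.1,
        polyMul_apply_eq_zero_of_mem_fst hp hS g.2.1]
  · obtain ⟨j, rfl⟩ := Nat.exists_eq_add_of_le (not_lt.1 hj)
    rw [f.2.2 j k, g.2.2 j k]

/-- The closure of the numerical range of the compression to `S₂` does not change when `S₂` is
replaced by the largest subspace of the model space that is invariant under `z₂`. -/
theorem smul_inner_mem_closure_numericalRange (hp : IsRationalInner p m n)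
    (hS : IsShiftDecomposition (rationalInner p m n) S₁ S₂) {f : H2Bidisk} (hf : f ∈ lowFst p m)
    (hf0 : f ≠ 0) :
    (‖f‖ ^ 2)⁻¹ • inner ℂ f (shift₁ f) ∈
      closure (numericalRange (compression shift₁ S₂.toSubmodule)) := by
  have hdec : ∀ N : ℕ, ∃ a ∈ S₁.toSubmodule, ∃ b ∈ S₂.toSubmodule, a + b = (shift₂ ^ N) f :=
    fun N => Submodule.mem_sup.1
      (hS.sup_eq ▸ lowFst_le_modelSpace hp (shift₂_pow_mem_lowFst hf N))
  choose a ha b hb hab using hdec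
  have hfin := finiteDimensional_fst_inf_lowFst hp hS
  -- Both `z₂ᴺ f` and its `S₂`-component belong to `lowFst`, hence so does the `S₁`-component.
  have haX : ∀ N, a N ∈ S₁.toSubmodule ⊓ lowFst p m := fun N => by
    refine ⟨ha N, ?_⟩
    rw [eq_sub_of_add_eq (hab N)]
    exact (lowFst p m).sub_mem (shift₂_pow_mem_lowFst hf N) (snd_le_lowFst hp hS (hb N))
  -- As `b N ⟂ S₁`, `a N` is the projection of `z₂ᴺ f` to a finite-dimensional space, where weak
  -- convergence to `0` is norm convergence.
  have ha0 : Tendsto (fun N => ‖a N‖) atTop (𝓝 0) := by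
    let B := stdOrthonormalBasis ℂ ↥(S₁.toSubmodule ⊓ lowFst p m)
    have h1 : ∀ N, ‖a N‖ ^ 2 = ∑ i, ‖inner ℂ (B i : H2Bidisk) ((shift₂ ^ N) f)‖ ^ 2 := by
      intro N
      refine (B.sum_sq_norm_inner_right ⟨a N, haX N⟩).symm.trans (Finset.sum_congr rfl fun i _ => ?_)
      rw [← hab N, inner_add_right,
        (Submodule.isOrtho_iff_inner_eq.1 hS.orthogonal) _ (B i).2.1 _ (hb N), add_zero]
      rfl
    have h2 : Tendsto (fun N => ‖a N‖ ^ 2) atTop (𝓝 0) := by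
      simp only [h1]
      have := tendsto_finsetSum (Finset.univ) fun i _ =>
        ((tendsto_inner_shift₂_pow (B i : H2Bidisk) f).norm.pow 2)
      simpa using this
    have h3 := (Real.continuous_sqrt.tendsto _).comp h2
    simpa [Function.comp_def, Real.sqrt_sq (norm_nonneg _)] using h3
  have hbF : ∀ N, b N = (shift₂ ^ N) f - a N := fun N => eq_sub_of_add_eq' (hab N)
  have hbn : Tendsto (fun N => ‖b N‖) atTop (𝓝 ‖f‖) := by
    rw [tendsto_iff_norm_sub_tendsto_zero]
    refine squeeze_zero (fun _ => norm_nonneg _) (fun N => ?_) ha0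
    rw [← norm_shift₂_pow N f]
    refine (abs_norm_sub_norm_le _ _).trans_eq ?_
    rw [hbF, sub_sub_cancel_left, norm_neg]
  refine mem_closure_numericalRange_of_tendsto (u := b) hb
    (pow_ne_zero 2 (norm_ne_zero_iff.2 hf0)) (hbn.pow 2) ?_
  rw [tendsto_iff_norm_sub_tendsto_zero]
  have hlim : Tendsto (fun N => ‖f‖ * ‖a N‖ + ‖a N‖ * ‖b N‖) atTop (𝓝 0) := by
    simpa using (ha0.const_mul ‖f‖).add (ha0.mul hbn)
  refine squeeze_zero (fun _ => norm_nonneg _) (fun N => ?_) hlim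
  have hF : inner ℂ f (shift₁ f) = inner ℂ ((shift₂ ^ N) f) (shift₁ ((shift₂ ^ N) f)) := by
    rw [shift₁_shift₂_pow, inner_shift₂_pow]
  have hsub : inner ℂ (b N) (shift₁ (b N)) - inner ℂ f (shift₁ f) =
      -(inner ℂ ((shift₂ ^ N) f) (shift₁ (a N)) + inner ℂ (a N) (shift₁ (b N))) := by
    rw [hF, ← hab N]
    simp only [map_add, inner_add_left, inner_add_right]
    ring
  rw [hsub, norm_neg]
  refine (norm_add_le _ _).trans (add_le_add ?_ ?_)
  · refine (norm_inner_le_norm _ _).trans_eq ?_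
    rw [norm_shift₁, norm_shift₂_pow]
  · refine (norm_inner_le_norm _ _).trans_eq ?_
    rw [norm_shift₁]

end Decomposition

end H2Bidisk

/-! ### Functions on the bidisk with bounded slices -/

section Bounded

/-- The coefficients of a bounded analytic function on the disk with values in an inner product
space are square-summable. -/
theorem sum_norm_sq_le_of_hasSum_of_norm_le {H : Type*} [NormedAddCommGroup H]
    [InnerProductSpace ℂ H] {w : ℕ → H} {R : ℂ → H} {K : ℝ}
    (hR : ∀ z : ℂ, ‖z‖ < 1 → HasSum (fun k => z ^ k • w k) (R z))
    (hK : ∀ z : ℂ, z ≠ 0 → ‖z‖ < 1 → ‖R z‖ ≤ K) (N : ℕ) :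
    ∑ k ∈ Finset.range N, ‖w k‖ ^ 2 ≤ K ^ 2 := by
  -- Parseval is applied on the circle of radius `s < 1`, which avoids the centre; afterwards `s →
  -- 1`.
  have hs : ∀ s : ℝ, 0 < s → s < 1 → ∑ k ∈ Finset.range N, (s ^ k * ‖w k‖) ^ 2 ≤ K ^ 2 := by
    intro s hs0 hs1
    -- Bounded terms at a larger radius `s'` give geometric, hence absolute, convergence at `s`.
    obtain ⟨s', hss', hs'1⟩ := exists_between hs1
    have hs'0 : 0 < s' := hs0.trans hss'
    have hsum : Summable fun k => s ^ k * ‖w k‖ := by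
      have h0 := (hR (s' : ℂ) (by rwa [Complex.norm_real, Real.norm_of_nonneg hs'0.le])
        ).summable.tendsto_atTop_zero.norm
      obtain ⟨M, hM⟩ := h0.bddAbove_range
      refine .of_nonneg_of_le (fun k => by positivity) (fun k => ?_)
        ((summable_geometric_of_lt_one (by positivity) ((div_lt_one hs'0).2 hss')).mul_left M)
      have h1 : s' ^ k * ‖w k‖ ≤ M := by
        have := hM (Set.mem_range_self k)
        simpa [norm_smul, abs_of_pos hs'0] using this
      calc s ^ k * ‖w k‖ = (s' ^ k * ‖w k‖) * (s / s') ^ k := by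
            rw [div_pow]; field_simp
        _ ≤ M * (s / s') ^ k := by gcongr
    -- The tail `ε n` bounds, uniformly on the circle, the distance of `R` from its `n`-th partial
    -- sum.
    let ε : ℕ → ℝ := fun n => ∑' k, s ^ (k + n) * ‖w (k + n)‖
    have hε : Tendsto ε atTop (𝓝 0) := tendsto_sum_nat_add fun k => s ^ k * ‖w k‖
    have hle : ∀ n ≥ N, ∑ k ∈ Finset.range N, (s ^ k * ‖w k‖) ^ 2 ≤ (K + ε n) ^ 2 := by
      intro n hn
      calc ∑ k ∈ Finset.range N, (s ^ k * ‖w k‖) ^ 2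
          ≤ ∑ k ∈ Finset.range n, ‖(s : ℂ) ^ k • w k‖ ^ 2 := by
            refine (Finset.sum_le_sum_of_subset_of_nonneg (Finset.range_mono hn)
              fun _ _ _ => by positivity).trans_eq (Finset.sum_congr rfl fun k _ => ?_)
            simp [norm_smul, abs_of_pos hs0]
        _ = ∫ t, ‖∑ k ∈ Finset.range n, circleExp t ^ k • (s : ℂ) ^ k • w k‖ ^ 2 ∂circleHaar :=
            (integral_norm_sum_circleExp_pow_smul_sq _ _).symm
        _ ≤ ∫ _, (K + ε n) ^ 2 ∂circleHaar := by
            refine integral_mono_of_nonneg (ae_of_all _ fun t => by positivity)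
              (integrable_const _) (ae_of_all _ fun t => ?_)
            have hz : ‖(s : ℂ) * circleExp t‖ = s := by simp [abs_of_pos hs0]
            have hz0 : (s : ℂ) * circleExp t ≠ 0 := norm_ne_zero_iff.1 (by rw [hz]; exact hs0.ne')
            have hsumR := hR _ (hz.trans_lt hs1)
            have hnorm : ∀ k, ‖((s : ℂ) * circleExp t) ^ k • w k‖ = s ^ k * ‖w k‖ := fun k => by
              rw [norm_smul, norm_pow, hz]
            have h1 : ‖R (s * circleExp t) -
                ∑ k ∈ Finset.range n, ((s : ℂ) * circleExp t) ^ k • w k‖ ≤ ε n := by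
              have h2 := ((hasSum_nat_add_iff' n).2 hsumR)
              have h3 : Summable fun k => ‖((s : ℂ) * circleExp t) ^ (k + n) • w (k + n)‖ := by
                simp only [hnorm]
                exact (summable_nat_add_iff (f := fun k => s ^ k * ‖w k‖) n).2 hsum
              rw [← h2.tsum_eq]
              refine (norm_tsum_le_tsum_norm h3).trans_eq ?_
              simp only [hnorm, ε]
            have h4 : (∑ k ∈ Finset.range n, circleExp t ^ k • (s : ℂ) ^ k • w k) =
                R (s * circleExp t) - (R (s * circleExp t) -
                  ∑ k ∈ Finset.range n, ((s : ℂ) * circleExp t) ^ k • w k) := by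
              rw [sub_sub_cancel]
              refine Finset.sum_congr rfl fun k _ => ?_
              rw [smul_smul, mul_pow, mul_comm]
            have h5 : ‖∑ k ∈ Finset.range n, circleExp t ^ k • (s : ℂ) ^ k • w k‖ ≤ K + ε n := by
              rw [h4]
              exact (norm_sub_le _ _).trans (add_le_add (hK _ hz0 (hz.trans_lt hs1)) h1)
            exact pow_le_pow_left₀ (norm_nonneg _) h5 2
        _ = (K + ε n) ^ 2 := by simp
    have hlim : Tendsto (fun n => (K + ε n) ^ 2) atTop (𝓝 (K ^ 2)) := by
      simpa using (hε.const_add K).pow 2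
    exact ge_of_tendsto hlim (eventually_atTop.2 ⟨N, hle⟩)
  have hcont : Continuous fun s : ℝ => ∑ k ∈ Finset.range N, (s ^ k * ‖w k‖) ^ 2 := by fun_prop
  have hlim := (hcont.tendsto 1).mono_left (nhdsWithin_le_nhds (s := Set.Iio 1))
  simp only [one_pow, one_mul] at hlim
  refine le_of_tendsto hlim ?_
  filter_upwards [Ioo_mem_nhdsLT zero_lt_one] with s hs'
  exact hs s hs'.1 hs'.2

theorem lp_two_norm_sq {ι : Type*} (f : lp (fun _ : ι => ℂ) 2) : ‖f‖ ^ 2 = ∑' i, ‖f i‖ ^ 2 := by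
  simpa using lp.norm_rpow_eq_tsum (p := 2) (by simp) f

theorem lp_two_summable_norm_sq {ι : Type*} (f : lp (fun _ : ι => ℂ) 2) :
    Summable fun i => ‖f i‖ ^ 2 := by
  simpa using (memℓp_gen_iff (p := 2) (by simp)).1 (lp.memℓp f)

namespace H2Bidisk

/-- A bounded analytic function on the disk with values in `H²(𝔻)` is a function in `H²(𝔻²)`. -/
theorem exists_eval_eq_of_norm_le {R : ℂ → H2Disk}
    (hR : DifferentiableOn ℂ R (Metric.ball 0 1)) {K : ℝ}
    (hK : ∀ z : ℂ, z ≠ 0 → ‖z‖ < 1 → ‖R z‖ ≤ K) :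
    ∃ f : H2Bidisk, ∀ z₁ z₂ : ℂ, ‖z₁‖ < 1 → ‖z₂‖ < 1 → f.eval z₁ z₂ = (R z₂).eval z₁ := by
  let w : ℕ → H2Disk := fun k => (k.factorial : ℂ)⁻¹ • iteratedDeriv k R 0
  have hsum : ∀ z : ℂ, ‖z‖ < 1 → HasSum (fun k => z ^ k • w k) (R z) := by
    intro z hz
    have := Complex.hasSum_taylorSeries_on_ball hR (z := z) (by simpa using hz)
    simpa only [sub_zero, smul_comm _ (z ^ _)] using this
  have hw : Summable fun k => ‖w k‖ ^ 2 :=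
    summable_of_sum_range_le (fun k => by positivity)
      (sum_norm_sq_le_of_hasSum_of_norm_le hsum hK)
  -- The Taylor index in `z₂` is the second coordinate, the index inside `H²(𝔻)` the first.
  have hmem : Memℓp (fun i : ℕ × ℕ => w i.2 i.1) 2 := by
    rw [memℓp_gen_iff (by simp)]
    have h : Summable fun i : ℕ × ℕ => ‖w i.1 i.2‖ ^ 2 := by
      rw [summable_prod_of_nonneg fun _ => by positivity]
      exact ⟨fun k => lp_two_summable_norm_sq (w k), by simpa only [← lp_two_norm_sq] using hw⟩
    refine (Equiv.prodComm ℕ ℕ).summable_iff.1 ?_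
    simpa [Function.comp_def] using h
  let f : H2Bidisk := ⟨_, hmem⟩
  refine ⟨f, fun z₁ z₂ h₁ h₂ => ?_⟩
  have hs : Summable fun i : ℕ × ℕ => w i.1 i.2 * (z₁ ^ i.2 * z₂ ^ i.1) :=
    (Equiv.prodComm ℕ ℕ).summable_iff.2 (summable_eval f h₁ h₂)
  have hf : f.eval z₁ z₂ = ∑' i : ℕ × ℕ, w i.1 i.2 * (z₁ ^ i.2 * z₂ ^ i.1) :=
    ((Equiv.prodComm ℕ ℕ).tsum_eq fun i : ℕ × ℕ => f i * (z₁ ^ i.1 * z₂ ^ i.2)).symm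
  rw [hf, hs.tsum_prod]
  have hR₂ := (H2Disk.evalCLM z₁ h₁).hasSum (hsum z₂ h₂)
  rw [← H2Disk.evalCLM_apply z₁ h₁, ← hR₂.tsum_eq]
  refine tsum_congr fun k => ?_
  rw [map_smul, H2Disk.evalCLM_apply, H2Disk.eval, smul_eq_mul, ← tsum_mul_left]
  refine tsum_congr fun j => ?_
  ring

/-- A polynomial `r` in the second variable that is dominated by `p` on `𝕋 × 𝔻` is divisible by
`p` in `H²(𝔻²)`. -/
theorem exists_polyMul_eq {p : MvPolynomial (Fin 2) ℂ} {m n : ℕ} (hp : IsRationalInner p m n)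
    {r : ℂ[X]} (hne : ∀ ζ z : ℂ, ‖ζ‖ = 1 → ‖z‖ < 1 → MvPolynomial.eval ![ζ, z] p ≠ 0)
    {K : ℝ} (hK0 : 0 ≤ K) (hK : ∀ ζ z : ℂ, ‖ζ‖ = 1 → z ≠ 0 → ‖z‖ ≤ 1 →
      ‖r.eval z‖ ≤ K * ‖MvPolynomial.eval ![ζ, z] p‖) :
    ∃ w : H2Bidisk, polyMul p w = Polynomial.aeval shift₂ r one := by
  let P : ℂ → H2Disk →L[ℂ] H2Disk := fun z => Polynomial.aeval H2Disk.shift (fstSlice p z)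
  have hP : Differentiable ℂ P := by
    have : P = fun z => ∑ s ∈ p.support, (p.coeff s * z ^ s 1) • H2Disk.shift ^ s 0 := by
      ext1 z
      ext1 f
      rw [H2Disk.aeval_fstSlice, sum_apply]
      rfl
    rw [this]
    fun_prop
  have hu : ∀ z : ℂ, ‖z‖ < 1 → IsUnit (P z) := fun z hz =>
    H2Disk.isUnit_aeval_shift fun ζ hζ => by
      rw [eval_fstSlice]
      rcases hζ.lt_or_eq with hζ | hζ
      · exact hp.eval_ne_zero ζ z hζ hz
      · exact hne ζ z hζ hz
  -- `R z` is the slice `r(z) / p(·, z)` of the quotient sought.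
  let R : ℂ → H2Disk := fun z => r.eval z • Ring.inverse (P z) H2Disk.one
  have hPR : ∀ z : ℂ, ‖z‖ < 1 → P z (R z) = r.eval z • H2Disk.one := fun z hz => by
    rw [map_smul, ← mul_apply_eq_comp, Ring.mul_inverse_cancel _ (hu z hz), one_apply_eq_self]
  have hR : DifferentiableOn ℂ R (Metric.ball 0 1) := by
    intro z hz
    have h1 : DifferentiableAt ℂ (fun z => Ring.inverse (P z)) z :=
      (differentiableAt_inverse (𝕜 := ℂ) (hu z (by simpa using hz))).comp z (hP z)
    exact (r.differentiable.differentiableAt.smul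
      (h1.clm_apply (differentiableAt_const _))).differentiableWithinAt
  have hRK : ∀ z : ℂ, z ≠ 0 → ‖z‖ < 1 → ‖R z‖ ≤ K := by
    intro z hz0 hz
    rcases eq_or_ne (r.eval z) 0 with h0 | h0
    · simpa [R, h0] using hK0
    · have hpos : 0 < ‖r.eval z‖ := norm_pos_iff.2 h0
      have hKpos : 0 < K := by
        refine hK0.lt_of_ne fun h => ?_
        have := hK 1 z (by simp) hz0 hz.le
        rw [← h, zero_mul] at this
        exact this.not_gt hpos
      -- On the circle `|p(·, z)| ≥ |r(z)| / K`, while `p(·, z) R z` is the constant `r(z)`;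
      -- cancelling `|r(z)|` leaves `‖R z‖ ≤ K`.
      have h1 := H2Disk.mul_norm_le_norm_aeval_shift (q := fstSlice p z) (c := ‖r.eval z‖ / K)
        (by positivity) (fun ζ hζ => by
          rw [eval_fstSlice, div_le_iff₀' hKpos]
          exact hK ζ z hζ hz0 hz.le) (R z)
      have h2 : ‖Polynomial.aeval H2Disk.shift (fstSlice p z) (R z)‖ = ‖r.eval z‖ := by
        refine (congrArg norm (hPR z hz)).trans ?_
        rw [norm_smul, H2Disk.norm_one_eq, mul_one]
      rw [h2, div_mul_eq_mul_div, div_le_iff₀ hKpos] at h1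
      exact le_of_mul_le_mul_left h1 hpos
  obtain ⟨w, hw⟩ := exists_eval_eq_of_norm_le hR hRK
  refine ⟨w, ext_eval fun z₁ z₂ h₁ h₂ => ?_⟩
  have h := congrArg (fun f => H2Disk.evalCLM z₁ h₁ f) (hPR z₂ h₂)
  simp only [map_smul, H2Disk.evalCLM_apply, H2Disk.eval_one, P, smul_eq_mul, mul_one] at h
  rw [H2Disk.eval_aeval_shift _ _ h₁, eval_fstSlice] at h
  rw [eval_polyMul _ _ h₁ h₂, hw z₁ z₂ h₁ h₂, h, eval_aeval_shift₂ _ _ h₁ h₂, eval_one, mul_one]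

end H2Bidisk

end Bounded

/-! ### Numerical ranges and slices -/

namespace H2Bidisk

theorem norm_sq_eq_integral (f : H2Bidisk) : ‖f‖ ^ 2 = ∫ t, ‖slice f t‖ ^ 2 ∂circleHaar := by
  have h := inner_eq_integral f f
  simp only [inner_self_eq_norm_sq_to_K] at h
  apply Complex.ofReal_injective
  rw [← integral_complex_ofReal]
  simpa using h

theorem integrable_norm_slice_sq (f : H2Bidisk) :
    Integrable (fun t => ‖slice f t‖ ^ 2) circleHaar := by
  refine (integrable_inner_slice f f).re.congr (ae_of_all _ fun t => ?_)
  exact inner_self_eq_norm_sq _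

theorem ae_inner_slice_shift₁ (f : H2Bidisk) :
    (fun t => inner ℂ (slice f t) (slice (shift₁ f) t)) =ᵐ[circleHaar]
      fun t => inner ℂ (slice f t) (H2Disk.shift (slice f t)) := by
  filter_upwards [actsOnSlices_shift₁ f] with t ht
  rw [ht]

variable {p : MvPolynomial (Fin 2) ℂ} {m n : ℕ} {S₁ S₂ : ClosedSubmodule ℂ H2Bidisk}

/-- The union of the numerical ranges of the compressed shifts of the slices. -/
def sliceRange (p : MvPolynomial (Fin 2) ℂ) (m n : ℕ) : Set ℂ :=
  ⋃ τ ∈ Metric.sphere (0 : ℂ) 1 \ exceptionalSet p,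
    numericalRange (H2Disk.compressedShift fun z => rationalInner p m n z τ)

/-- The value is an integral of points of `sliceRange` with weights `‖f_t‖²` of total mass `1`, so
no real functional can separate it strictly from the closed convex hull. -/
theorem inner_shift₁_mem_closure_convexHull (hp : IsRationalInner p m n) {f : H2Bidisk}
    (hf : f ∈ lowFst p m) (hf1 : ‖f‖ = 1) :
    inner ℂ f (shift₁ f) ∈ closure (convexHull ℝ (sliceRange p m n)) := by
  by_contra hc
  obtain ⟨φ, u, hφ, hu⟩ := geometric_hahn_banach_closed_point
    (convex_convexHull ℝ (sliceRange p m n)).closure isClosed_closure hc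
  have hae : ∀ᵐ t ∂circleHaar,
      φ (inner ℂ (slice f t) (H2Disk.shift (slice f t))) ≤ u * ‖slice f t‖ ^ 2 := by
    filter_upwards [ae_slice_mem_modelSpace hp hf, ae_circleExp_notMem_exceptionalSet hp]
      with t ht hE
    rcases eq_or_ne (slice f t) 0 with h0 | h0
    · simp [h0]
    · have hmem : (‖slice f t‖ ^ 2)⁻¹ • inner ℂ (slice f t) (H2Disk.shift (slice f t)) ∈
          sliceRange p m n :=
        Set.mem_biUnion (x := circleExp t) ⟨by simp, hE⟩
          (smul_inner_mem_numericalRange_compression ht h0)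
      have h1 := (hφ _ (subset_closure (subset_convexHull ℝ _ hmem))).le
      have hpos : 0 < ‖slice f t‖ ^ 2 := by positivity
      rw [map_smul, smul_eq_mul, inv_mul_le_iff₀ hpos] at h1
      rwa [mul_comm]
  have hint := (integrable_inner_slice f (shift₁ f)).congr (ae_inner_slice_shift₁ f)
  have h1 : φ (inner ℂ f (shift₁ f)) ≤ u := by
    rw [inner_eq_integral, integral_congr_ae (ae_inner_slice_shift₁ f),
      ← φ.integral_comp_comm hint]
    refine (integral_mono_ae (φ.integrable_comp hint)
      ((integrable_norm_slice_sq f).const_mul u) hae).trans_eq ?_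
    rw [integral_const_mul, ← norm_sq_eq_integral, hf1, one_pow, mul_one]
  exact h1.not_gt hu

theorem ae_slice_one : ∀ᵐ t ∂circleHaar, slice one t = H2Disk.one := by
  have h : slice one = sliceMonomial (0, 0) := by rw [one, slice_single, one_smul]
  rw [h]
  filter_upwards [coeFn_sliceMonomial (0, 0)] with t ht
  rw [ht]
  simp

theorem aeval_shift₂_mem_lowFst (q : ℂ[X]) {f : H2Bidisk} (hf : f ∈ lowFst p m) :
    Polynomial.aeval shift₂ q f ∈ lowFst p m := by
  rw [Polynomial.aeval_eq_sum_range, sum_apply]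
  exact Submodule.sum_mem _ fun k _ =>
    (lowFst p m).smul_mem _ (shift₂_pow_mem_lowFst hf k)

theorem aeval_shift_one_apply_eq_zero {q r : ℂ[X]} (hq : ∀ j, q.coeff (m + j) = 0) (j k : ℕ) :
    Polynomial.aeval shift₂ r (Polynomial.aeval shift₁ q one) (m + j, k) = 0 := by
  have h : ∀ k, Polynomial.aeval shift₁ q one (m + j, k) = 0 := by
    intro k
    rw [Polynomial.aeval_eq_sum_range, sum_apply, lp.coeFn_sum, Finset.sum_apply]
    refine Finset.sum_eq_zero fun i _ => ?_
    rw [smul_apply, lp.coeFn_smul, Pi.smul_apply, shift₁_pow_apply]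
    rcases lt_or_ge i m with hi | hi
    · rw [if_pos (by omega), one, lp.single_apply_ne _ _ _ (by simp; omega), smul_zero]
    · obtain ⟨i, rfl⟩ := Nat.exists_eq_add_of_le hi
      rw [hq, zero_smul]
  rw [Polynomial.aeval_eq_sum_range, sum_apply, lp.coeFn_sum, Finset.sum_apply]
  refine Finset.sum_eq_zero fun i _ => ?_
  rw [smul_apply, lp.coeFn_smul, Pi.smul_apply, shift₂_pow_apply]
  split_ifs
  · rw [h, smul_zero]
  · rw [smul_zero]

theorem norm_one_add_sq_lt {u : ℂ} (hu : ‖u‖ = 1) (hu1 : u ≠ 1) : ‖1 + u‖ ^ 2 < 4 := by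
  have h : u.re * u.re + u.im * u.im = 1 := by
    rw [← Complex.normSq_apply, Complex.normSq_eq_norm_sq, hu, one_pow]
  have hre : u.re < 1 := by
    refine lt_of_le_of_ne ((Complex.re_le_norm u).trans_eq hu) fun h1 => hu1 ?_
    have him : u.im = 0 := by
      rw [h1] at h
      have : u.im * u.im = 0 := by linarith
      simpa using this
    exact Complex.ext h1 him
  rw [← Complex.normSq_eq_norm_sq, Complex.normSq_apply]
  simp
  nlinarith

/-- Integrals against the powers of `|1 + conj(e(t₁)) e(t)|²` concentrate at `t₁`. -/
theorem tendsto_integral_peak {E : Type*} [NormedAddCommGroup E] [NormedSpace ℝ E]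
    [CompleteSpace E] (t₁ : UnitAddCircle) {g : UnitAddCircle → E}
    (hg : Integrable g circleHaar) (hgc : ContinuousAt g t₁) :
    Tendsto (fun N : ℕ => (∫ t, (‖1 + conj (circleExp t₁) * circleExp t‖ ^ 2) ^ N ∂circleHaar)⁻¹ •
      ∫ t, (‖1 + conj (circleExp t₁) * circleExp t‖ ^ 2) ^ N • g t ∂circleHaar) atTop
      (𝓝 (g t₁)) := by
  have hcont := continuous_circleExp
  have hconj : conj (circleExp t₁) * circleExp t₁ = 1 := by
    rw [Complex.conj_mul', norm_circleExp]; simp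
  have h := tendsto_setIntegral_pow_smul_of_unique_maximum_of_isCompact_of_integrableOn
    (μ := circleHaar) (s := Set.univ) (x₀ := t₁) isCompact_univ
    (c := fun t => ‖1 + conj (circleExp t₁) * circleExp t‖ ^ 2)
    (by fun_prop) (fun t _ ht => ?_) (fun t _ => by positivity)
    (by simp only [hconj]; norm_num) (by simp) hg.integrableOn hgc.continuousWithinAt
  · simpa only [Measure.restrict_univ] using h
  · simp only [hconj]
    refine (norm_one_add_sq_lt (by simp) fun h1 => ht (circleExp_injective ?_)).trans_eq
      (by norm_num)
    rw [← one_mul (circleExp t), ← hconj, mul_comm (conj _), mul_assoc, h1, mul_one]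

/-- The fractions `q / p(·, τ)` with `deg q < m` are approximated by the slices of functions whose
mass concentrates at `τ`. -/
theorem smul_inner_inverse_mem_closure (hp : IsRationalInner p m n)
    (hS : IsShiftDecomposition (rationalInner p m n) S₁ S₂) {r : ℂ[X]}
    {w : H2Bidisk}
    (hw : polyMul p w = Polynomial.aeval shift₂ r one) {q : ℂ[X]}
    (hq : ∀ j, q.coeff (m + j) = 0) {t₁ : UnitAddCircle} (hr : r.eval (circleExp t₁) ≠ 0)
    {h : UnitAddCircle → H2Disk}
    (hdef : ∀ t, h t = Ring.inverse (Polynomial.aeval H2Disk.shift (fstSlice p (circleExp t)))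
      (Polynomial.aeval H2Disk.shift q H2Disk.one))
    (hc : ContinuousAt h t₁) (h0 : h t₁ ≠ 0) :
    (‖h t₁‖ ^ 2)⁻¹ • inner ℂ (h t₁) (H2Disk.shift (h t₁)) ∈
      closure (numericalRange (compression shift₁ S₂.toSubmodule)) := by
  -- `G` is `q r / p`; its product with `p` is `q(z₁) r(z₂)`, of `z₁`-degree less than `m`.
  set G : H2Bidisk := Polynomial.aeval shift₁ q w
  have hpG : polyMul p G = Polynomial.aeval shift₂ r (Polynomial.aeval shift₁ q one) := by
    refine ext_eval fun z₁ z₂ h₁ h₂ => ?_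
    have := congrArg (fun f : H2Bidisk => f.eval z₁ z₂) hw
    simp only [eval_polyMul _ _ h₁ h₂, eval_aeval_shift₂ _ _ h₁ h₂] at this
    simp only [G, eval_polyMul _ _ h₁ h₂, eval_aeval_shift₂ _ _ h₁ h₂,
      eval_aeval_shift₁ _ _ h₁ h₂]
    linear_combination (q.eval z₁) * this
  have hG : G ∈ lowFst p m := fun j k => by rw [hpG, aeval_shift_one_apply_eq_zero hq]
  set g : UnitAddCircle → H2Disk := fun t => r.eval (circleExp t) • h t
  have hslice : ∀ᵐ t ∂circleHaar, slice G t = g t := by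
    have h1 := actsOnSlices_polyMul p G
    rw [hpG] at h1
    filter_upwards [h1, actsOnSlices_aeval_shift₂ r (Polynomial.aeval shift₁ q one),
      actsOnSlices_shift₁.aeval q one, ae_slice_one, ae_circleExp_notMem_exceptionalSet hp]
      with t h₁ h₂ h₃ h₄ hE
    have hu := H2Disk.isUnit_aeval_shift (q := fstSlice p (circleExp t)) fun z hz => by
      simpa using hp.eval_ne_zero_of_notMem_exceptionalSet hz (norm_circleExp t) hE
    rw [h₂, h₃, h₄, smul_apply, one_apply_eq_self] at h₁
    simp only [g]
    rw [hdef, ← map_smul, h₁, ← mul_apply_eq_comp, Ring.inverse_mul_cancel _ hu,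
      one_apply_eq_self]
  have hcont := continuous_circleExp
  have hgc : ContinuousAt g t₁ := by
    have : Continuous fun t => r.eval (circleExp t) := r.continuous.comp hcont
    exact this.continuousAt.smul hc
  have hg0 : g t₁ ≠ 0 := smul_ne_zero hr h0
  have hint₁ : Integrable (fun t => inner ℂ (g t) (H2Disk.shift (g t))) circleHaar := by
    refine ((integrable_inner_slice G (shift₁ G)).congr (ae_inner_slice_shift₁ G)).congr ?_
    filter_upwards [hslice] with t ht
    rw [ht]
  have hint₀ : Integrable (fun t => ‖g t‖ ^ 2) circleHaar := by
    refine (integrable_norm_slice_sq G).congr ?_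
    filter_upwards [hslice] with t ht
    rw [ht]
  -- On the circle `|φ N|²` is the peaking kernel at `t₁`, and multiplication by a polynomial in
  -- `z₂` keeps `G` in `lowFst`.
  let φ : ℕ → ℂ[X] := fun N => (1 + Polynomial.C (conj (circleExp t₁)) * Polynomial.X) ^ N
  let F : ℕ → H2Bidisk := fun N => Polynomial.aeval shift₂ (φ N) G
  have hφ : ∀ N t, ‖(φ N).eval (circleExp t)‖ ^ 2 =
      (‖1 + conj (circleExp t₁) * circleExp t‖ ^ 2) ^ N := fun N t => by
    simp only [φ, Polynomial.eval_pow, Polynomial.eval_add, Polynomial.eval_one,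
      Polynomial.eval_mul, Polynomial.eval_C, Polynomial.eval_X, norm_pow]
    ring
  have hF : ∀ N, ∀ᵐ t ∂circleHaar, slice (F N) t = (φ N).eval (circleExp t) • g t := fun N => by
    filter_upwards [actsOnSlices_aeval_shift₂ (φ N) G, hslice] with t h₁ h₂
    rw [h₁, h₂]
    rfl
  have hF₁ : ∀ N, inner ℂ (F N) (shift₁ (F N)) =
      ∫ t, (‖1 + conj (circleExp t₁) * circleExp t‖ ^ 2) ^ N •
        inner ℂ (g t) (H2Disk.shift (g t)) ∂circleHaar := fun N => by
    rw [inner_eq_integral, integral_congr_ae (ae_inner_slice_shift₁ (F N))]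
    refine integral_congr_ae ?_
    filter_upwards [hF N] with t ht
    rw [ht, ← hφ, map_smul, inner_smul_left, inner_smul_right, ← mul_assoc, Complex.conj_mul',
      Complex.real_smul, Complex.ofReal_pow]
  have hF₀ : ∀ N, ‖F N‖ ^ 2 =
      ∫ t, (‖1 + conj (circleExp t₁) * circleExp t‖ ^ 2) ^ N • ‖g t‖ ^ 2 ∂circleHaar := fun N => by
    rw [norm_sq_eq_integral]
    refine integral_congr_ae ?_
    filter_upwards [hF N] with t ht
    rw [ht, norm_smul, mul_pow, hφ, smul_eq_mul]
  have hlim₁ := tendsto_integral_peak t₁ hint₁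
    (hgc.inner (H2Disk.shift.continuous.continuousAt.comp hgc))
  have hlim₀ := tendsto_integral_peak t₁ hint₀ (hgc.norm.pow 2)
  simp only [← hF₁] at hlim₁
  simp only [← hF₀] at hlim₀
  have hg0' : ‖g t₁‖ ^ 2 ≠ 0 := by simpa using hg0
  -- The nonzero scalar `r(e(t₁))` cancels in the quotient.
  have hval : (‖h t₁‖ ^ 2)⁻¹ • inner ℂ (h t₁) (H2Disk.shift (h t₁)) =
      (‖g t₁‖ ^ 2)⁻¹ • inner ℂ (g t₁) (H2Disk.shift (g t₁)) := by
    have hr' : (‖r.eval (circleExp t₁)‖ : ℂ) ≠ 0 := by simpa using hr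
    simp only [g]
    rw [map_smul, inner_smul_left, inner_smul_right, ← mul_assoc, Complex.conj_mul', norm_smul,
      Complex.real_smul, Complex.real_smul]
    push_cast
    field_simp
  rw [hval, ← closure_closure]
  refine mem_closure_of_tendsto ((hlim₀.inv₀ hg0').smul hlim₁) ?_
  filter_upwards [hlim₀.eventually_ne hg0'] with N hN
  rw [smul_eq_mul] at hN
  have hF0 : F N ≠ 0 := fun h => right_ne_zero_of_mul hN (by simp [h])
  have hI := inv_eq_zero.not.1 (left_ne_zero_of_mul hN)
  -- The total mass of the kernel normalizes both limits and cancels in their quotient.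
  rw [smul_eq_mul, smul_smul, mul_inv, inv_inv, mul_right_comm, mul_inv_cancel₀ hI, one_mul]
  exact smul_inner_mem_closure_numericalRange hp hS (aeval_shift₂_mem_lowFst _ hG) hF0

/-- If `r(τ) = 0`, no mass can be concentrated at `τ` directly. With the numerator `q` fixed, the
quotient for `q / p(·, τ')` is continuous at `τ' = τ`, and `r` has no zeros at nearby points `τ' ≠
τ`. -/
theorem sliceRange_subset_closure (hp : IsRationalInner p m n)
    (hS : IsShiftDecomposition (rationalInner p m n) S₁ S₂) :
    sliceRange p m n ⊆ closure (numericalRange (compression shift₁ S₂.toSubmodule)) := by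
  intro c hc
  obtain ⟨τ, ⟨hτ, hE⟩, hc⟩ := Set.mem_iUnion₂.1 hc
  have hτ : ‖τ‖ = 1 := by simpa using hτ
  obtain ⟨t₀, rfl⟩ := exists_circleExp_eq hτ
  obtain ⟨h₀, hK, hn, rfl⟩ := mem_numericalRange_compression.1 hc
  obtain ⟨r, hr, hrE, hne, K, hK0, hK'⟩ := hp.exists_dominated
  obtain ⟨w, hw⟩ := exists_polyMul_eq hp hne hK0 hK'
  let P : UnitAddCircle → H2Disk →L[ℂ] H2Disk := fun t =>
    Polynomial.aeval H2Disk.shift (fstSlice p (circleExp t))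
  have hcont := continuous_circleExp
  have hP : Continuous P := by
    have : P = fun t => ∑ s ∈ p.support, (p.coeff s * circleExp t ^ s 1) • H2Disk.shift ^ s 0 := by
      ext1 t
      ext1 f
      rw [H2Disk.aeval_fstSlice, sum_apply]
      rfl
    rw [this]
    fun_prop
  have hu : IsUnit (P t₀) := H2Disk.isUnit_aeval_shift fun z hz => by
    simpa using hp.eval_ne_zero_of_notMem_exceptionalSet hz hτ hE
  rw [H2Disk.mem_modelSpace_iff hp hτ hE] at hK
  -- The numerator `p(·, τ) h₀`, which has no coefficients from `m` on because `h₀` lies in the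
  -- model space.
  let q : ℂ[X] := ∑ j ∈ Finset.range m, Polynomial.monomial j (P t₀ h₀ j)
  have hcoeff : ∀ j, q.coeff j = if j < m then P t₀ h₀ j else 0 := fun j => by
    simp [q, Polynomial.finsetSum_coeff, Polynomial.coeff_monomial]
  have hq : ∀ j, q.coeff (m + j) = 0 := fun j => by rw [hcoeff, if_neg (by omega)]
  have hqv : Polynomial.aeval H2Disk.shift q H2Disk.one = P t₀ h₀ := by
    refine lp.ext (funext fun j => ?_)
    rw [H2Disk.aeval_shift_one_apply, hcoeff]
    split_ifs with hj
    · rfl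
    · obtain ⟨j, rfl⟩ := Nat.exists_eq_add_of_le (not_lt.1 hj)
      exact (hK j).symm
  let h : UnitAddCircle → H2Disk := fun t =>
    Ring.inverse (P t) (Polynomial.aeval H2Disk.shift q H2Disk.one)
  have hh₀ : h t₀ = h₀ := by
    simp only [h]
    rw [hqv, ← mul_apply_eq_comp, Ring.inverse_mul_cancel _ hu, one_apply_eq_self]
  have hcts : ∀ t, IsUnit (P t) → ContinuousAt h t := by
    intro t ht
    obtain ⟨u, hu⟩ := ht
    have h1 : ContinuousAt Ring.inverse (P t) := hu ▸ NormedRing.inverse_continuousAt u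
    exact (h1.comp hP.continuousAt).clm_apply continuousAt_const
  have hB : ContinuousAt
      (fun t => (‖h t‖ ^ 2)⁻¹ • inner ℂ (h t) (H2Disk.shift (h t))) t₀ := by
    have h1 := hcts t₀ hu
    refine ((h1.norm.pow 2).inv₀ ?_).smul
      (h1.inner (H2Disk.shift.continuous.continuousAt.comp h1))
    simp [hh₀, hn]
  have hlim := hB.tendsto.mono_left (nhdsWithin_le_nhds (s := {t₀}ᶜ))
  simp only [hh₀, hn, one_pow, inv_one, one_smul] at hlim
  rw [← closure_closure]
  -- If `t₀` were isolated, `{t₀}` would be an open set of Haar measure zero.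
  have hneBot : (𝓝[≠] t₀).NeBot := ⟨fun h =>
    ((isOpen_singleton_iff_punctured_nhds t₀).2 h).measure_ne_zero circleHaar
      (Set.singleton_nonempty t₀) (measure_singleton t₀)⟩
  refine mem_closure_of_tendsto hlim ?_
  have hrfin : {t | r.eval (circleExp t) = 0}.Finite :=
    (Polynomial.finite_setOfPred_isRoot hr).preimage circleExp_injective.injOn
  filter_upwards [nhdsNE_le_cofinite t₀ hrfin.compl_mem_cofinite,
    nhdsWithin_le_nhds ((hcts t₀ hu).eventually_ne
      (by rw [hh₀]; exact norm_ne_zero_iff.1 (by rw [hn]; exact one_ne_zero)))] with t ht ht0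
  refine smul_inner_inverse_mem_closure hp hS hw hq ht (fun _ => rfl) (hcts t ?_) ht0
  -- Since `r` vanishes on the exceptional set, avoiding its zeros also avoids that set.
  exact H2Disk.isUnit_aeval_shift fun z hz => by
    simpa using hp.eval_ne_zero_of_notMem_exceptionalSet hz (norm_circleExp t)
      fun h => ht (hrE _ h)

end H2Bidisk

end

theorem theorem3p4 (m n : ℕ) (p : MvPolynomial (Fin 2) ℂ) (hp : IsRationalInner p m n)
    (S₁ S₂ : ClosedSubmodule ℂ H2Bidisk)
    (hS : IsShiftDecomposition (rationalInner p m n) S₁ S₂) :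
    (exceptionalSet p).Finite ∧
    closure (numericalRange (compression H2Bidisk.shift₁ S₂.toSubmodule)) =
      closure (convexHull ℝ
        (⋃ τ ∈ Metric.sphere (0 : ℂ) 1 \ exceptionalSet p,
          numericalRange (H2Disk.compressedShift fun z => rationalInner p m n z τ))) := by
  refine ⟨hp.finite_exceptionalSet, subset_antisymm ?_ ?_⟩
  · refine closure_minimal (fun c hc => ?_) isClosed_closure
    obtain ⟨f, hf, hf1, rfl⟩ := mem_numericalRange_compression.1 hc
    exact H2Bidisk.inner_shift₁_mem_closure_convexHull hp (H2Bidisk.snd_le_lowFst hp hS hf) hf1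
  · exact closure_minimal (convexHull_min (H2Bidisk.sliceRange_subset_closure hp hS)
      (H2Bidisk.convex_closure_numericalRange_compression hS.shift₂_mem)) isClosed_closure
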